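/- Let $G$ be a locally compact abelian (Hausdorff) group with dual group $\widehat G$, and let $\theta_G$, $\theta_{\widehat G}$ be Haar measures on $G$ and $\widehat G$, inner regular with respect to compact sets on measurable sets of finite measure. The Fourier transform $f\mapsto\widehat f$ from $L^2(G)$ to $L^2(\widehat G)$ is the continuous extension of $\widehat f(\chi)=\int_G f(x)\overline{\chi(x)}\,d\theta_G(x)$ from $L^1(G)\cap L^2(G)$. For a locally compact abelian group $X$ with Haar measure $\theta$ and a function $f$ on $X$ (either $f\in L^2(X)$ or an indicator function $f=1_K$ of a measurable set), put $$\operatorname{supp}(f)=\Big\{x\in X:\ \int_U|f|^2\,d\theta>0\ \text{ for all open } U\ni x\Big\}.$$ For measurable $K\subset X$ let $L^2(X:K)=\{f\in L^2(X):\operatorname{supp}(f)\subset K\}$ and $L^2(K)=\{f\in L^2(X): f=0 \text{ a.e. on } X\setminus K\}$. Then the following hold. (1) For every measurable $K\subset\widehat G$, the spaces $\{f\in L^2(G):\operatorname{supp}(\widehat f)\subset K\}$ and $\mathrm{PW}_K=\{f\in L^2(G):\widehat f=0\text{ a.e. on }\widehat G\setminus K\}$ are equal if and only if $\operatorname{supp}(1_K)\subset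 K$. In particular, they are equal if $K$ is closed in $\widehat G$. (2) For every measurable $K\subset G$, $$\overline{L^2(G:K)}=L^2(K)\subset L^2(G:\operatorname{supp}(1_K)),$$ and the inclusion is an equality if and only if every compact subset of $\operatorname{supp}(1_K)\setminus K$ has Haar measure zero; if $\theta_G$ is inner regular with respect to compact sets on all measurable sets, this is equivalent to $\theta_G(\operatorname{supp}(1_K)\setminus K)=0$. (3) For every measurable $K\subset G$, one has $\operatorname{supp}(1_K)\subset K$ if and only if $L^2(G:K)$ is a closed subspace of $L^2(G)$. (4) If $K\subset G$ is closed, then $L^2(G:K)$ is closed in $L^2(G)$ and $\overline{L^2(G:K)}=L^2(K)=L^2(G:\operatorname{supp}(1_K))$. -/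

import Mathlib

open MeasureTheory Topology
open scoped ENNReal

noncomputable section

namespace PaleyWiener

theorem lintegral_sq_eq_zero {X : Type*} [MeasurableSpace X] {μ : Measure X} (f : Lp ℂ 2 μ) {U : Set X} :
    ∫⁻ y in U, ‖f y‖ₑ ^ 2 ∂μ = 0 ↔ ∀ᵐ y ∂(μ.restrict U), f y = 0 := by
  have hf : AEMeasurable (fun y => ‖f y‖ₑ ^ 2) (μ.restrict U) :=
    ((Lp.aestronglyMeasurable f).restrict.enorm).pow_const 2
  rw [lintegral_eq_zero_iff' hf]
  refine Filter.eventually_congr (Filter.Eventually.of_forall fun y => ?_)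
  simp

section Support

variable {X : Type*} [TopologicalSpace X] [MeasurableSpace X]

/-- The support of `f` with respect to `μ`: the points `x` such that
`∫_U |f|² dμ > 0` for every open `U ∋ x`. -/
def supp (μ : Measure X) (f : X → ℂ) : Set X :=
  {x | ∀ U : Set X, IsOpen U → x ∈ U → 0 < ∫⁻ y in U, ‖f y‖ₑ ^ 2 ∂μ}

/-- The indicator function `1_K`, with complex values. -/
def ind (K : Set X) : X → ℂ := K.indicator fun _ => 1

theorem notMem_supp {μ : Measure X} {f : X → ℂ} {x : X} :
    x ∉ supp μ f ↔ ∃ U : Set X, IsOpen U ∧ x ∈ U ∧ ∫⁻ y in U, ‖f y‖ₑ ^ 2 ∂μ = 0 := by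
  simp [supp]

/-- `L²(X : K)`, the subspace of those `f ∈ L²(X, μ)` with `supp f ⊆ K`. -/
def L2Supp (μ : Measure X) (K : Set X) : Submodule ℂ (Lp ℂ 2 μ) where
  carrier := {f | supp μ f ⊆ K}
  zero_mem' := by
    intro x hx
    by_contra
    refine notMem_supp.2 ⟨Set.univ, isOpen_univ, trivial, ?_⟩ hx
    rw [lintegral_sq_eq_zero]
    filter_upwards [ae_restrict_of_ae (Lp.coeFn_zero ℂ 2 μ)] with y hy using hy
  add_mem' := by
    intro f g hf hg x hx
    by_contra hxK
    obtain ⟨U, hU, hxU, hfU⟩ := notMem_supp.1 fun h => hxK (hf h)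
    obtain ⟨V, hV, hxV, hgV⟩ := notMem_supp.1 fun h => hxK (hg h)
    refine notMem_supp.2 ⟨U ∩ V, hU.inter hV, ⟨hxU, hxV⟩, ?_⟩ hx
    rw [lintegral_sq_eq_zero] at hfU hgV ⊢
    filter_upwards [ae_restrict_of_ae (Lp.coeFn_add f g),
      ae_restrict_of_ae_restrict_of_subset Set.inter_subset_left hfU,
      ae_restrict_of_ae_restrict_of_subset Set.inter_subset_right hgV] with y h1 h2 h3
    rw [h1, Pi.add_apply, h2, h3, add_zero]
  smul_mem' := by
    intro c f hf x hx
    by_contra hxK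
    obtain ⟨U, hU, hxU, hfU⟩ := notMem_supp.1 fun h => hxK (hf h)
    refine notMem_supp.2 ⟨U, hU, hxU, ?_⟩ hx
    rw [lintegral_sq_eq_zero] at hfU ⊢
    filter_upwards [ae_restrict_of_ae (Lp.coeFn_smul c f), hfU] with y h1 h2
    rw [h1, Pi.smul_apply, h2, smul_zero]

/-- `L²(K)`, the subspace of those `f ∈ L²(X, μ)` that vanish almost everywhere off `K`. -/
def L2On (μ : Measure X) (K : Set X) : Submodule ℂ (Lp ℂ 2 μ) where
  carrier := {f | ∀ᵐ x ∂μ, x ∉ K → f x = 0}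
  zero_mem' := by
    filter_upwards [Lp.coeFn_zero ℂ 2 μ] with y hy _ using hy
  add_mem' := by
    intro f g hf hg
    rw [Set.mem_ofPred_eq] at hf hg ⊢
    filter_upwards [Lp.coeFn_add f g, hf, hg] with y h1 h2 h3 hy
    rw [h1, Pi.add_apply, h2 hy, h3 hy, add_zero]
  smul_mem' := by
    intro c f hf
    rw [Set.mem_ofPred_eq] at hf ⊢
    filter_upwards [Lp.coeFn_smul c f, hf] with y h1 h2 hy
    rw [h1, Pi.smul_apply, h2 hy, smul_zero]

end Support

section Fourier

variable {G : Type*} [CommGroup G] [TopologicalSpace G] [MeasurableSpace G]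
  [MeasurableSpace (PontryaginDual G)]

/-- The Fourier transform `f̂(χ) = ∫ f(x) conj(χ(x)) dθ(x)` of an integrable function `f`. -/
def fourierInt (θ : Measure G) (f : G → ℂ) (χ : PontryaginDual G) : ℂ :=
  ∫ x, f x * (starRingEnd ℂ) (χ x : ℂ) ∂θ

open Classical in
/-- For `f ∈ L¹ ∩ L²`, the integral Fourier transform `f̂` as an element of `L²` of the dual group
(by Plancherel's theorem, the second case never occurs for `f ∈ L¹ ∩ L²`; values at other `f` are
never used). -/
def fourierL1L2 (θ : Measure G) (θ' : Measure (PontryaginDual G)) (f : Lp ℂ 2 θ) : Lp ℂ 2 θ' :=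
  if h : MemLp (fourierInt θ f) 2 θ' then h.toLp (fourierInt θ f) else 0

/-- The Fourier transform on `L²(G)`: the continuous extension of the integral Fourier
transform from the dense subspace `L¹(G) ∩ L²(G)` to `L²(G)`. -/
def fourierL2 (θ : Measure G) (θ' : Measure (PontryaginDual G)) : Lp ℂ 2 θ → Lp ℂ 2 θ' :=
  extendFrom {f : Lp ℂ 2 θ | Integrable f θ} (fourierL1L2 θ θ')

/-- The Paley-Wiener space `PW_K = {f ∈ L²(G) : f̂ = 0 a.e. off K}`. -/
def PW (θ : Measure G) (θ' : Measure (PontryaginDual G)) (K : Set (PontryaginDual G)) :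
    Set (Lp ℂ 2 θ) :=
  {f | ∀ᵐ χ ∂θ', χ ∉ K → fourierL2 θ θ' f χ = 0}

/-- The space `{f ∈ L²(G) : supp f̂ ⊆ K}`. -/
def PWSupp (θ : Measure G) (θ' : Measure (PontryaginDual G)) (K : Set (PontryaginDual G)) :
    Set (Lp ℂ 2 θ) :=
  {f | supp θ' (fourierL2 θ θ' f) ⊆ K}

end Fourier

end PaleyWiener

end

/-! Everything about the spaces on `G` is measure theory; the statement about `PW_K` then follows by
transport along the Fourier transform, once Plancherel's theorem is available.

Measure theory. A function in L² lives on a σ-finite set, so inner regularity on sets of finite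
measure lets null statements be tested on compact sets, where an open cover reduces to a finite one.
Hence `f` vanishes a.e. off `supp f`, so L²(X:K) ⊆ L²(K). The space L²(K) is closed, and cutting `f`
down to compact `C ⊆ K` gives functions supported in `K` that approximate it; so L²(K) is the
closure of L²(X:K) (`topologicalClosure_L2Supp`). The two spaces agree exactly when supp(1_K) ⊆ K
(`L2Supp_eq_L2On_iff`); the test functions are indicators of `K` near a point, and for the criterion
with compact sets, indicators of compact sets.

Transport. The sets `PWSupp` and `PW` are preimages of L²(Ĝ:K) and L²(K) under the Fourier
transform. Preimages under a surjection determine the set, so surjectivity of the transform is what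
is needed (`surjective_plancherel`).

Plancherel, with arbitrary Haar measures. Convolution operators lie in a commutative C⋆-algebra of
operators on L²(G). Its characters that do not kill all of them come from characters of `G`, so the
Gelfand transform bounds the norm of convolution by `g` by the sup norm of ĝ. As the ĝ are dense in
C₀(Ĝ), this gives a functional calculus `spectralMap`, and each `f` defines a functional φ ↦ ⟨f,
φ·f⟩ on C₀(Ĝ). Commutativity of convolution relates the functionals of `f` and `g`; averaging over
translations of Ĝ shows that |ĝ|² dθ' is a constant multiple of the functional of `g`
(`exists_integral_mul_sqFourier_eq`). Comparing total masses gives ‖ĝ‖₂ = C‖g‖₂, and the range is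
closed and dense. -/

open scoped CompactlySupported ZeroAtInfty Pointwise InnerProductSpace

noncomputable section

namespace PaleyWiener

/-! ### Supports, and the spaces L²(X:K) and L²(K) -/

section SupportTheory

variable {X : Type*} [TopologicalSpace X] [MeasurableSpace X] {μ : Measure X}

theorem isClosed_supp (f : X → ℂ) : IsClosed (supp μ f) := by
  rw [← isOpen_compl_iff, isOpen_iff_forall_mem_open]
  intro x hx
  obtain ⟨U, hU, hxU, h⟩ := notMem_supp.1 hx
  exact ⟨U, fun y hy => notMem_supp.2 ⟨U, hU, hy, h⟩, hU, hxU⟩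

theorem lintegral_ind_sq {K : Set X} (hK : NullMeasurableSet K μ) (U : Set X) :
    ∫⁻ y in U, ‖ind K y‖ₑ ^ 2 ∂μ = μ (K ∩ U) := by
  have : (fun y => ‖ind K y‖ₑ ^ 2) = K.indicator 1 := by
    ext y
    by_cases hy : y ∈ K <;> simp [ind, hy]
  rw [this, lintegral_indicator_one₀ (hK.mono_ac Measure.restrict_le_self.absolutelyContinuous),
    Measure.restrict_apply₀ (hK.mono_ac Measure.restrict_le_self.absolutelyContinuous)]

theorem supp_ind_subset_of_isClosed [OpensMeasurableSpace X] {K : Set X} (hK : IsClosed K) :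
    supp μ (ind K) ⊆ K := by
  intro x hx
  by_contra h
  refine notMem_supp.2 ⟨Kᶜ, hK.isOpen_compl, h, ?_⟩ hx
  rw [lintegral_ind_sq hK.measurableSet.nullMeasurableSet, Set.inter_compl_self, measure_empty]

theorem L2Supp_mono {K L : Set X} (h : K ⊆ L) : L2Supp μ K ≤ L2Supp μ L :=
  fun _ hf => Set.Subset.trans hf h

theorem L2On_le_L2Supp_supp_ind {K : Set X} (hK : NullMeasurableSet K μ) :
    L2On μ K ≤ L2Supp μ (supp μ (ind K)) := by
  intro f hf x hx
  by_contra h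
  obtain ⟨U, hU, hxU, hUK⟩ := notMem_supp.1 h
  rw [lintegral_ind_sq hK] at hUK
  refine notMem_supp.2 ⟨U, hU, hxU, ?_⟩ hx
  rw [lintegral_sq_eq_zero]
  have h1 : ∀ᵐ y ∂(μ.restrict U), y ∉ K := by
    rw [ae_iff]
    simp only [not_not, Set.ofPred_mem_eq]
    rw [Measure.restrict_apply₀ (hK.mono_ac Measure.restrict_le_self.absolutelyContinuous)]
    exact hUK
  have hf' : ∀ᵐ x ∂μ, x ∉ K → f x = 0 := hf
  filter_upwards [h1, ae_restrict_of_ae hf'] with y hy1 hy2 using hy2 hy1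

theorem isClosed_L2On (K : Set X) : IsClosed (L2On μ K : Set (Lp ℂ 2 μ)) := by
  rw [← isSeqClosed_iff_isClosed]
  intro u f hu huf
  obtain ⟨ns, _, hns⟩ := (tendstoInMeasure_of_tendsto_Lp huf).exists_seq_tendsto_ae
  have hu' : ∀ n, ∀ᵐ x ∂μ, x ∉ K → u n x = 0 := hu
  change ∀ᵐ x ∂μ, x ∉ K → f x = 0
  filter_upwards [hns, ae_all_iff.2 hu'] with x hx hux hxK
  refine tendsto_nhds_unique hx ?_
  simp [hux _ hxK]

variable [R1Space X] [BorelSpace X]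

/-- An `L²` function vanishing almost everywhere on all compact subsets of `S` vanishes almost
everywhere on `S`. -/
theorem ae_eq_zero_of_forall_isCompact [μ.InnerRegularCompactLTTop] (f : Lp ℂ 2 μ) {S : Set X}
    (hS : NullMeasurableSet S μ)
    (h : ∀ C, IsCompact C → C ⊆ S → ∀ᵐ x ∂μ, x ∈ C → f x = 0) :
    ∀ᵐ x ∂μ, x ∈ S → f x = 0 := by
  -- Chebyshev makes the level sets of `f` finite in measure, which is where inner regularity is
  -- available.
  have hlevel : ∀ n : ℕ, μ (S ∩ {x | (1 / (n + 1 : ℝ)) ≤ ‖f x‖}) = 0 := by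
    intro n
    by_contra h0
    have hpos : (0 : ℝ) < 1 / (n + 1) := by positivity
    have hmeas : MeasurableSet {x | (1 / (n + 1 : ℝ)) ≤ ‖f x‖} :=
      measurableSet_le measurable_const (Lp.stronglyMeasurable f).norm.measurable
    have hfin : μ {x | (1 / (n + 1 : ℝ)) ≤ ‖f x‖} < ∞ := by
      have := (Lp.memLp f).meas_ge_lt_top (p := 2) (by simp) (by simp)
        (ε := (1 / (n + 1) : NNReal)) (by positivity)
      refine lt_of_eq_of_lt (congrArg μ ?_) this
      ext x
      simp [← NNReal.coe_le_coe]
    obtain ⟨T, hTS, hT, hTeq⟩ :=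
      (hS.inter hmeas.nullMeasurableSet).exists_measurable_subset_ae_eq
    have hTpos : 0 < μ T := by
      rw [measure_congr hTeq]; exact pos_iff_ne_zero.2 h0
    have hTfin : μ T ≠ ∞ :=
      ((measure_mono (hTS.trans Set.inter_subset_right)).trans_lt hfin).ne
    obtain ⟨C, hCT, hC, hCpos⟩ := hT.exists_lt_isCompact_of_ne_top hTfin hTpos
    have hCz := h C hC (hCT.trans (hTS.trans Set.inter_subset_left))
    refine hCpos.ne' (measure_mono_null ?_ (ae_iff.1 hCz))
    intro x hx
    have : (1 / (n + 1 : ℝ)) ≤ ‖f x‖ := (hTS (hCT hx)).2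
    simp only [Set.mem_ofPred_eq, Classical.not_imp]
    exact ⟨hx, fun h0 => by rw [h0, norm_zero] at this; linarith⟩
  have hall := measure_iUnion_null hlevel
  rw [ae_iff]
  refine measure_mono_null ?_ hall
  intro x hx
  simp only [Set.mem_ofPred_eq, Classical.not_imp] at hx
  obtain ⟨n, hn⟩ := exists_nat_one_div_lt (norm_pos_iff.2 hx.2)
  exact Set.mem_iUnion.2 ⟨n, hx.1, hn.le⟩

/-- Each point off the support has an open neighbourhood on which `f` is null, but countably many of
these need not suffice. A compact set off the support is covered by finitely many of them, and
compact sets are enough to test on. -/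
theorem ae_eq_zero_of_notMem_supp [μ.InnerRegularCompactLTTop] (f : Lp ℂ 2 μ) :
    ∀ᵐ x ∂μ, x ∉ supp μ f → f x = 0 := by
  refine ae_eq_zero_of_forall_isCompact f (S := (supp μ f)ᶜ)
    (isClosed_supp _).isOpen_compl.measurableSet.nullMeasurableSet fun C hC hCS => ?_
  have hms : MeasurableSet {x | f x ≠ 0} :=
    (Lp.stronglyMeasurable f).measurable (measurableSet_singleton 0).compl
  have h0 : μ.restrict {x | f x ≠ 0} C = 0 := by
    refine hC.measure_zero_of_nhdsWithin fun x hx => ?_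
    obtain ⟨U, hU, hxU, h⟩ := notMem_supp.1 (hCS hx)
    refine ⟨U, mem_nhdsWithin_of_mem_nhds (hU.mem_nhds hxU), ?_⟩
    rw [lintegral_sq_eq_zero, ae_restrict_iff' hU.measurableSet, ae_iff] at h
    rw [Measure.restrict_apply' hms]
    refine measure_mono_null ?_ h
    intro y hy
    simpa using! hy
  rw [Measure.restrict_apply' hms] at h0
  rw [ae_iff]
  refine measure_mono_null ?_ h0
  intro y hy
  simpa using! hy

theorem L2Supp_le_L2On [μ.InnerRegularCompactLTTop] (K : Set X) : L2Supp μ K ≤ L2On μ K := by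
  intro f hf
  change ∀ᵐ x ∂μ, x ∉ K → f x = 0
  filter_upwards [ae_eq_zero_of_notMem_supp f] with x hx hxK using hx fun h => hxK (hf h)

theorem supp_subset_of_isClosed {f : X → ℂ} {C : Set X} (hC : IsClosed C)
    (h : ∀ᵐ x ∂μ, x ∉ C → f x = 0) : supp μ f ⊆ C := by
  intro x hx
  by_contra hxC
  refine notMem_supp.2 ⟨Cᶜ, hC.isOpen_compl, hxC, ?_⟩ hx
  refine (lintegral_congr_ae (g := 0) ?_).trans (by simp)
  filter_upwards [ae_restrict_of_ae h, ae_restrict_mem hC.isOpen_compl.measurableSet] with y h1 h2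
  simp [h1 h2]

/-- For `x` in supp(1_K) the test function is the indicator of `K ∩ V`, with `V` a relatively
compact neighbourhood of `x`. It is in L² because `V` has finite measure, and `x` lies in its
support. -/
theorem supp_ind_subset_of_L2On_le [LocallyCompactSpace X] [IsFiniteMeasureOnCompacts μ]
    {K : Set X} (hK : NullMeasurableSet K μ) (h : L2On μ K ≤ L2Supp μ K) :
    supp μ (ind K) ⊆ K := by
  intro x hx
  obtain ⟨V, hV, hxV, hVc⟩ := exists_isOpen_superset_and_isCompact_closure
    (isCompact_singleton (x := x))
  have hxV' : x ∈ V := hxV rfl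
  have hVfin : μ V ≠ ∞ := ((measure_mono subset_closure).trans_lt hVc.measure_lt_top).ne
  obtain ⟨T, hTK, hT, hTeq⟩ := hK.exists_measurable_subset_ae_eq
  have hTV : μ (T ∩ V) ≠ ∞ := ((measure_mono Set.inter_subset_right).trans_lt hVfin.lt_top).ne
  let f : Lp ℂ 2 μ := indicatorConstLp 2 (hT.inter hV.measurableSet) hTV 1
  have hf : f =ᵐ[μ] (T ∩ V).indicator fun _ => 1 := indicatorConstLp_coeFn
  have hfK : f ∈ L2On μ K := by
    change ∀ᵐ x ∂μ, x ∉ K → f x = 0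
    filter_upwards [hf] with y hy hyK
    rw [hy, Set.indicator_of_notMem fun h => hyK (hTK h.1)]
  refine h hfK ?_
  intro U hU hxU
  have h1 := hx (U ∩ V) (hU.inter hV) ⟨hxU, hxV'⟩
  rw [lintegral_ind_sq hK] at h1
  have : ∫⁻ y in U, ‖f y‖ₑ ^ 2 ∂μ = μ (T ∩ V ∩ U) := by
    rw [← lintegral_ind_sq (hT.inter hV.measurableSet).nullMeasurableSet]
    refine lintegral_congr_ae ?_
    filter_upwards [ae_restrict_of_ae hf] with y hy
    rw [hy]; rfl
  rw [this]
  refine h1.trans_eq ?_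
  rw [Set.inter_assoc, Set.inter_comm V U]
  exact (measure_congr (hTeq.inter (ae_eq_refl _))).symm

theorem L2Supp_eq_L2On_iff [LocallyCompactSpace X] [IsFiniteMeasureOnCompacts μ]
    [μ.InnerRegularCompactLTTop] {K : Set X} (hK : NullMeasurableSet K μ) :
    L2Supp μ K = L2On μ K ↔ supp μ (ind K) ⊆ K :=
  ⟨fun h => supp_ind_subset_of_L2On_le hK h.ge, fun h => le_antisymm (L2Supp_le_L2On K)
    ((L2On_le_L2Supp_supp_ind hK).trans (L2Supp_mono h))⟩

/-- A function in `Lᵖ ∩ L^q` vanishing off `K` is approximated in both norms by its restrictions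
to compact subsets of `K`. -/
theorem exists_isCompact_eLpNorm_indicator_compl_le [T2Space X] [μ.InnerRegularCompactLTTop]
    {p q : ℝ≥0∞} (hp : 1 ≤ p) (hp' : p ≠ ∞) (hq : 1 ≤ q) (hq' : q ≠ ∞) {f : X → ℂ}
    (hfp : MemLp f p μ) (hfq : MemLp f q μ) {K : Set X} (hK : NullMeasurableSet K μ)
    (hfK : ∀ᵐ x ∂μ, x ∉ K → f x = 0) {ε : ℝ} (hε : 0 < ε) :
    ∃ C, IsCompact C ∧ C ⊆ K ∧ eLpNorm (Cᶜ.indicator f) p μ ≤ ENNReal.ofReal ε ∧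
      eLpNorm (Cᶜ.indicator f) q μ ≤ ENNReal.ofReal ε := by
  have hε2 : 0 < ε / 2 := by positivity
  have hε2' : ENNReal.ofReal (ε / 2) ≠ 0 := by simpa using hε2
  obtain ⟨s, hs, hsμ, hsp⟩ := hfp.exists_eLpNorm_indicator_compl_lt hp' hε2'
  obtain ⟨t, ht, htμ, htq⟩ := hfq.exists_eLpNorm_indicator_compl_lt hq' hε2'
  obtain ⟨δ, hδ, hδp⟩ := hfp.eLpNorm_indicator_le hp hp' hε2
  obtain ⟨δ', hδ', hδq⟩ := hfq.eLpNorm_indicator_le hq hq' hε2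
  obtain ⟨T, hTK, hT, hTeq⟩ := hK.exists_measurable_subset_ae_eq
  have hA : MeasurableSet ((s ∪ t) ∩ T) := (hs.union ht).inter hT
  have hAμ : μ ((s ∪ t) ∩ T) ≠ ∞ :=
    ((measure_mono Set.inter_subset_left).trans_lt ((measure_union_le s t).trans_lt
      (ENNReal.add_lt_top.2 ⟨hsμ, htμ⟩))).ne
  obtain ⟨C, hCA, hC, hCμ⟩ := hA.exists_isCompact_sdiff_lt hAμ
    (ε := ENNReal.ofReal (min δ δ')) (by simp [hδ, hδ'])
  have hTc : ∀ᵐ x ∂μ, x ∉ T → f x = 0 := by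
    filter_upwards [hfK, hTeq.mem_iff] with x h1 h2 h3 using h1 fun h => h3 (h2.2 h)
  -- Up to a null set, `f` off `C` is dominated by its tail off `s'` plus its part on `((s ∪ t) ∩ T)
  -- \ C`, a set so small that uniform integrability applies. The same `C` serves both exponents,
  -- with `s' = s` for `p` and `s' = t` for `q`.
  have key : ∀ r : ℝ≥0∞, 1 ≤ r → ∀ s' ⊆ s ∪ t, MeasurableSet s' →
      AEStronglyMeasurable f μ → eLpNorm (s'ᶜ.indicator f) r μ < ENNReal.ofReal (ε / 2) →
      (∀ u, MeasurableSet u → μ u ≤ ENNReal.ofReal (min δ δ') →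
        eLpNorm (u.indicator f) r μ ≤ ENNReal.ofReal (ε / 2)) →
      eLpNorm (Cᶜ.indicator f) r μ ≤ ENNReal.ofReal ε := by
    intro r hr s' hs' hs'm hfm h1 h2
    have hu : MeasurableSet (((s ∪ t) ∩ T) \ C) := hA.diff hC.measurableSet
    calc eLpNorm (Cᶜ.indicator f) r μ
        ≤ eLpNorm (fun x => ‖s'ᶜ.indicator f x‖ + ‖(((s ∪ t) ∩ T) \ C).indicator f x‖) r μ := by
          refine eLpNorm_mono_ae ?_
          filter_upwards [hTc] with x hx
          rw [Real.norm_of_nonneg (by positivity)]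
          by_cases hxs : x ∈ s'
          · by_cases hxC : x ∈ C
            · simp [hxC]
            · by_cases hxT : x ∈ T
              · have hm : x ∈ ((s ∪ t) ∩ T) \ C := ⟨⟨hs' hxs, hxT⟩, hxC⟩
                simp [Set.indicator_of_mem hm, hxC, hxs]
              · have h0 := hx hxT
                have : Cᶜ.indicator f x = 0 := by simp [Set.indicator_apply, h0]
                rw [this, norm_zero]
                positivity
          · have : ‖Cᶜ.indicator f x‖ ≤ ‖f x‖ := norm_indicator_le_norm_self _ _
            simp only [Set.indicator_of_mem (show x ∈ s'ᶜ from hxs)]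
            linarith [norm_nonneg ((((s ∪ t) ∩ T) \ C).indicator f x)]
      _ ≤ eLpNorm (fun x => ‖s'ᶜ.indicator f x‖) r μ +
          eLpNorm (fun x => ‖(((s ∪ t) ∩ T) \ C).indicator f x‖) r μ :=
          eLpNorm_add_le (hfm.indicator hs'm.compl).norm (hfm.indicator hu).norm hr
      _ ≤ ENNReal.ofReal (ε / 2) + ENNReal.ofReal (ε / 2) := by
          rw [eLpNorm_norm, eLpNorm_norm]
          exact add_le_add h1.le (h2 _ hu hCμ.le)
      _ = ENNReal.ofReal ε := by
          rw [← ENNReal.ofReal_add hε2.le hε2.le, add_halves]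
  refine ⟨C, hC, hCA.trans (Set.inter_subset_right.trans hTK), ?_, ?_⟩
  · exact key p hp s Set.subset_union_left hs hfp.1 hsp fun u hu huμ =>
      hδp u hu (huμ.trans (ENNReal.ofReal_le_ofReal (min_le_left _ _)))
  · exact key q hq t Set.subset_union_right ht hfp.1 htq fun u hu huμ =>
      hδq u hu (huμ.trans (ENNReal.ofReal_le_ofReal (min_le_right _ _)))

theorem topologicalClosure_L2Supp [T2Space X] [μ.InnerRegularCompactLTTop] {K : Set X}
    (hK : NullMeasurableSet K μ) : (L2Supp μ K).topologicalClosure = L2On μ K := by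
  refine le_antisymm (Submodule.topologicalClosure_minimal _ (L2Supp_le_L2On K)
    (isClosed_L2On K)) fun f hf => ?_
  change f ∈ closure (L2Supp μ K : Set (Lp ℂ 2 μ))
  rw [Metric.mem_closure_iff]
  intro ε hε
  obtain ⟨C, hC, hCK, hCε, -⟩ := exists_isCompact_eLpNorm_indicator_compl_le (p := 2) (q := 2)
    (by norm_num) (by simp) (by norm_num) (by simp) (Lp.memLp f) (Lp.memLp f) hK hf
    (half_pos hε)
  have hmem := (Lp.memLp f).indicator hC.measurableSet
  refine ⟨hmem.toLp _, ?_, ?_⟩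
  · refine (supp_subset_of_isClosed hC.isClosed ?_).trans hCK
    filter_upwards [hmem.coeFn_toLp] with x hx hxC
    rw [hx, Set.indicator_of_notMem hxC]
  · rw [Lp.dist_def]
    have : eLpNorm (⇑f - ⇑(hmem.toLp (C.indicator f))) 2 μ = eLpNorm (Cᶜ.indicator f) 2 μ := by
      refine eLpNorm_congr_ae ?_
      filter_upwards [hmem.coeFn_toLp] with x hx
      rw [Pi.sub_apply, hx]
      by_cases hxC : x ∈ C <;> simp [hxC]
    rw [this]
    exact (ENNReal.toReal_le_of_le_ofReal (by positivity) hCε).trans_lt (half_lt_self hε)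

/-- A compact `C` in the difference has its indicator in the larger space, and membership in L²(K)
forces `C` to be null. Conversely, compact sets detect whether an L² function vanishes on the
difference. -/
theorem L2On_eq_L2Supp_supp_ind_iff [T2Space X] [IsFiniteMeasureOnCompacts μ]
    [μ.InnerRegularCompactLTTop] {K : Set X} (hK : NullMeasurableSet K μ) :
    L2On μ K = L2Supp μ (supp μ (ind K)) ↔
      ∀ C : Set X, IsCompact C → C ⊆ supp μ (ind K) \ K → μ C = 0 := by
  constructor
  · intro h C hC hCK
    have hf : indicatorConstLp 2 hC.measurableSet hC.measure_ne_top (1 : ℂ) =ᵐ[μ]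
        C.indicator fun _ => 1 := indicatorConstLp_coeFn
    have hmem : indicatorConstLp 2 hC.measurableSet hC.measure_ne_top (1 : ℂ) ∈ L2On μ K := by
      rw [h]
      refine (supp_subset_of_isClosed hC.isClosed ?_).trans fun x hx => (hCK hx).1
      filter_upwards [hf] with x hx hxC
      rw [hx, Set.indicator_of_notMem hxC]
    have hmem' : ∀ᵐ x ∂μ, x ∉ K →
        indicatorConstLp 2 hC.measurableSet hC.measure_ne_top (1 : ℂ) x = 0 := hmem
    refine measure_eq_zero_iff_ae_notMem.2 ?_
    filter_upwards [hf, hmem'] with x h1 h2 hxC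
    have h3 := h2 (hCK hxC).2
    rw [h1, Set.indicator_of_mem hxC] at h3
    exact one_ne_zero h3
  · intro h
    refine le_antisymm (L2On_le_L2Supp_supp_ind hK) fun f hf => ?_
    have h1 : ∀ᵐ x ∂μ, x ∉ supp μ (ind K) → f x = 0 := L2Supp_le_L2On _ hf
    have h2 := ae_eq_zero_of_forall_isCompact f (S := supp μ (ind K) \ K)
      ((isClosed_supp _).measurableSet.nullMeasurableSet.diff hK) fun C hC hCS =>
        (measure_eq_zero_iff_ae_notMem.1 (h C hC hCS)).mono fun x hx hxC => (hx hxC).elim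
    change ∀ᵐ x ∂μ, x ∉ K → f x = 0
    filter_upwards [h1, h2] with x hx1 hx2 hxK
    by_cases hx : x ∈ supp μ (ind K)
    · exact hx2 ⟨hx, hxK⟩
    · exact hx1 hx

theorem measure_eq_zero_iff_forall_isCompact [μ.InnerRegular] {S : Set X}
    (hS : NullMeasurableSet S μ) :
    μ S = 0 ↔ ∀ C : Set X, IsCompact C → C ⊆ S → μ C = 0 := by
  refine ⟨fun h C _ hCS => measure_mono_null hCS h, fun h => ?_⟩
  obtain ⟨T, hTS, hT, hTeq⟩ := hS.exists_measurable_subset_ae_eq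
  rw [← measure_congr hTeq, hT.measure_eq_iSup_isCompact]
  simp only [ENNReal.iSup_eq_zero]
  exact fun C hCT hC => h C hC (hCT.trans hTS)

/-- Both conditions say that L²(X:K) equals its closure L²(K). -/
theorem supp_ind_subset_iff_isClosed_L2Supp [T2Space X] [LocallyCompactSpace X]
    [IsFiniteMeasureOnCompacts μ] [μ.InnerRegularCompactLTTop] {K : Set X}
    (hK : NullMeasurableSet K μ) :
    supp μ (ind K) ⊆ K ↔ IsClosed (L2Supp μ K : Set (Lp ℂ 2 μ)) := by
  rw [← L2Supp_eq_L2On_iff hK, ← topologicalClosure_L2Supp hK]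
  constructor
  · intro h
    rw [h]
    exact Submodule.isClosed_topologicalClosure _
  · intro h
    exact h.submodule_topologicalClosure_eq.symm

end SupportTheory

/-! ### Density of compactly supported continuous functions in L² -/

section Density

variable {X : Type*} [TopologicalSpace X] [T2Space X] [LocallyCompactSpace X]

theorem exists_cutoff {K U : Set X} (hK : IsCompact K) (hU : IsOpen U) (hKU : K ⊆ U) :
    ∃ η : C_c(X, ℝ), Set.EqOn η 1 K ∧ tsupport η ⊆ U ∧ ∀ x, η x ∈ Set.Icc (0 : ℝ) 1 := by
  obtain ⟨V, hV, hKV, hVU, hVc⟩ := exists_open_between_and_isCompact_closure hK hU hKU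
  obtain ⟨η, h1, h2, h3⟩ := exists_tsupport_one_of_isOpen_isClosed hV hVc hK.isClosed hKV
  exact ⟨⟨η, hVc.of_isClosed_subset (isClosed_tsupport _) (h1.trans subset_closure)⟩, h2,
    h1.trans (subset_closure.trans hVU), h3⟩

variable [MeasurableSpace X] [BorelSpace X]

theorem exists_hasCompactSupport_eLpNorm_sub_le {μ : Measure X} [IsFiniteMeasureOnCompacts μ]
    [μ.InnerRegularCompactLTTop] {p : ℝ≥0∞} (hp : p ≠ ∞) {f : X → ℂ} (hf : MemLp f p μ)
    {ε : ℝ≥0∞} (hε : ε ≠ 0) :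
    ∃ g : X → ℂ, eLpNorm (f - g) p μ ≤ ε ∧ Continuous g ∧ HasCompactSupport g := by
  refine hf.induction_dense hp (fun g => Continuous g ∧ HasCompactSupport g) ?_ ?_ ?_ hε
  · intro c t ht htμ ε hε
    obtain ⟨η, ηpos, hη⟩ := exists_eLpNorm_indicator_le (μ := μ) hp c hε
    have hη2 : ((η / 2 : NNReal) : ℝ≥0∞) ≠ 0 := by simpa using ηpos.ne'
    obtain ⟨C, hCt, hC, hCμ⟩ := ht.exists_isCompact_sdiff_lt htμ.ne hη2
    obtain ⟨U, hCU, hU, hUμ⟩ := hC.exists_isOpen_lt_add (μ := μ) hη2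
    obtain ⟨ψ, hψ1, hψU, hψ⟩ := exists_cutoff hC hU hCU
    refine ⟨fun x => (ψ x : ℂ) * c, ?_, ?_, ?_⟩
    -- The cut-off and the indicator of `t` differ only on `(U \ C) ∪ (t \ C)`, by at most `‖c‖`.
    -- Outer regularity is used for the compact set `C` only.
    · refine (eLpNorm_mono fun x => ?_).trans (hη ((U \ C) ∪ (t \ C)) ?_)
      · rw [Pi.sub_apply]
        by_cases hxC : x ∈ C
        · have : ψ x = 1 := hψ1 hxC
          simp [this, hCt hxC]
        · by_cases hxU : x ∈ U
          · have h01 := hψ x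
            rw [Set.indicator_of_mem (s := U \ C ∪ t \ C) (Or.inl ⟨hxU, hxC⟩)]
            by_cases hxt : x ∈ t
            · rw [Set.indicator_of_mem hxt]
              have : (ψ x : ℂ) * c - c = ((ψ x - 1 : ℝ) : ℂ) * c := by push_cast; ring
              rw [this, norm_mul, Complex.norm_real]
              refine mul_le_of_le_one_left (norm_nonneg _) ?_
              rw [Real.norm_eq_abs, abs_le]
              constructor <;> linarith [h01.1, h01.2]
            · rw [Set.indicator_of_notMem hxt, sub_zero, norm_mul, Complex.norm_real,
                Real.norm_of_nonneg h01.1]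
              exact mul_le_of_le_one_left (norm_nonneg _) h01.2
          · have : ψ x = 0 := image_eq_zero_of_notMem_tsupport fun h => hxU (hψU h)
            by_cases hxt : x ∈ t <;> simp [this, hxt, hxC, hxU]
      · have hUC : μ (U \ C) ≤ (η / 2 : NNReal) := by
          rw [measure_sdiff hCU hC.measurableSet.nullMeasurableSet hC.measure_ne_top]
          exact tsub_le_iff_left.2 hUμ.le
        refine (measure_union_le _ _).trans ((add_le_add hUC hCμ.le).trans_eq ?_)
        rw [← ENNReal.coe_add, add_halves]
    · have := ψ.continuous
      fun_prop
    · exact (ψ.hasCompactSupport.comp_left (g := fun r : ℝ => (r : ℂ)) (by simp)).mul_right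
  · exact fun f g hf hg => ⟨hf.1.add hg.1, hf.2.add hg.2⟩
  · exact fun f hf => (hf.1.memLp_of_hasCompactSupport (p := p) (μ := μ) hf.2).1

/-- Simultaneous approximation in `L²` and `L^q`, `q ≤ 2`, by continuous functions with compact
support. -/
theorem exists_eLpNorm_sub_le {μ : Measure X} [IsFiniteMeasureOnCompacts μ]
    [μ.InnerRegularCompactLTTop] {q : ℝ≥0∞} (hq : 1 ≤ q) (hq2 : q ≤ 2) {f : X → ℂ}
    (hf : MemLp f 2 μ) (hfq : MemLp f q μ) {ε : ℝ} (hε : 0 < ε) :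
    ∃ g : C_c(X, ℂ), eLpNorm (f - ⇑g) 2 μ ≤ ENNReal.ofReal ε ∧
      eLpNorm (f - ⇑g) q μ ≤ ENNReal.ofReal ε := by
  have hq' : q ≠ ∞ := (hq2.trans_lt (by simp)).ne
  have hε2 : 0 < ε / 2 := by positivity
  obtain ⟨C, hC, -, hC2, hCq⟩ := exists_isCompact_eLpNorm_indicator_compl_le (p := 2) (q := q)
    (by norm_num) (by simp) hq hq' hf hfq (K := Set.univ) MeasurableSet.univ.nullMeasurableSet
    (by simp) hε2
  obtain ⟨V, hV, hCV, hVc⟩ := exists_isOpen_superset_and_isCompact_closure hC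
  have hVfin : μ V < ∞ := (measure_mono subset_closure).trans_lt hVc.measure_lt_top
  have : Fact (μ V < ∞) := ⟨hVfin⟩
  obtain ⟨η, hη1, hηV, hη⟩ := exists_cutoff hC hV hCV
  -- Hölder's constant on `V`: since `V` has finite measure, an L² bound there controls the L^q
  -- norm, so it suffices to approximate in L² on `V` and cut off.
  set M : ℝ≥0∞ := (μ.restrict V) Set.univ ^ (1 / q.toReal - 1 / (2 : ℝ≥0∞).toReal) with hM
  have hqr : 1 / (2 : ℝ≥0∞).toReal ≤ 1 / q.toReal := by
    have h1 : 0 < q.toReal := ENNReal.toReal_pos (by positivity) hq'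
    exact one_div_le_one_div_of_le h1 (ENNReal.toReal_mono (by simp) hq2)
  have hMfin : M ≠ ∞ := ENNReal.rpow_ne_top_of_nonneg (by linarith) (measure_ne_top _ _)
  obtain ⟨δ, hδ, hδ1, hδM⟩ : ∃ δ : ℝ≥0∞, δ ≠ 0 ∧ δ ≤ ENNReal.ofReal (ε / 2) ∧
      δ * M ≤ ENNReal.ofReal (ε / 2) := by
    have he : ENNReal.ofReal (ε / 2) ≠ 0 := by simpa using hε
    have hM1 : M + 1 ≠ ∞ := by simp [hMfin]
    -- Dividing by `M + 1` rather than `M` secures both bounds at once, also when `M` is small or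
    -- zero.
    refine ⟨ENNReal.ofReal (ε / 2) / (M + 1), (ENNReal.div_pos he hM1).ne',
      ENNReal.div_le_of_le_mul (le_mul_of_one_le_right' le_add_self), ?_⟩
    calc ENNReal.ofReal (ε / 2) / (M + 1) * M ≤ ENNReal.ofReal (ε / 2) / (M + 1) * (M + 1) := by
          gcongr; exact le_self_add
      _ = ENNReal.ofReal (ε / 2) := ENNReal.div_mul_cancel (by simp) hM1
  have hCf : MemLp (C.indicator f) 2 μ := hf.indicator hC.measurableSet
  obtain ⟨g, hg, hgcont, hgc⟩ := exists_hasCompactSupport_eLpNorm_sub_le (by simp)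
    (hCf.restrict V) hδ
  let ηg : C_c(X, ℂ) := ⟨⟨fun x => (η x : ℂ) * g x, by
    have := η.continuous
    fun_prop⟩, hgc.mul_left⟩
  have hsub : ∀ r : ℝ≥0∞, 1 ≤ r → eLpNorm (Cᶜ.indicator f) r μ ≤ ENNReal.ofReal (ε / 2) →
      eLpNorm (C.indicator f - g) r (μ.restrict V) ≤ ENNReal.ofReal (ε / 2) →
      eLpNorm (f - ⇑ηg) r μ ≤ ENNReal.ofReal ε := by
    intro r hr h1 h2
    have hsm : AEStronglyMeasurable (C.indicator f - g) μ := hCf.1.sub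
      (hgcont.memLp_of_hasCompactSupport (p := 2) hgc).1
    calc eLpNorm (f - ⇑ηg) r μ
        ≤ eLpNorm (fun x => ‖Cᶜ.indicator f x‖ + ‖V.indicator (C.indicator f - g) x‖) r μ := by
          refine eLpNorm_mono fun x => ?_
          rw [Real.norm_of_nonneg (by positivity)]
          change ‖f x - η x * g x‖ ≤ _
          by_cases hxC : x ∈ C
          · have : η x = 1 := hη1 hxC
            simp [this, hxC, hCV hxC]
          · by_cases hxV : x ∈ V
            · have h01 := hη x
              have : ‖(η x : ℂ) * g x‖ ≤ ‖g x‖ := by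
                rw [norm_mul, Complex.norm_real, Real.norm_of_nonneg h01.1]
                exact mul_le_of_le_one_left (norm_nonneg _) h01.2
              simp only [Set.indicator_of_mem (show x ∈ Cᶜ from hxC), Set.indicator_of_mem hxV,
                Pi.sub_apply, Set.indicator_of_notMem hxC, zero_sub, norm_neg]
              exact (norm_sub_le _ _).trans (by gcongr)
            · have : η x = 0 := image_eq_zero_of_notMem_tsupport fun h => hxV (hηV h)
              simp [this, hxC, hxV]
      _ ≤ eLpNorm (fun x => ‖Cᶜ.indicator f x‖) r μ +
          eLpNorm (fun x => ‖V.indicator (C.indicator f - g) x‖) r μ :=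
          eLpNorm_add_le (hf.1.indicator hC.measurableSet.compl).norm
            (hsm.indicator hV.measurableSet).norm hr
      _ ≤ ENNReal.ofReal (ε / 2) + ENNReal.ofReal (ε / 2) := by
          rw [eLpNorm_norm, eLpNorm_norm, eLpNorm_indicator_eq_eLpNorm_restrict hV.measurableSet]
          exact add_le_add h1 h2
      _ = ENNReal.ofReal ε := by
          rw [← ENNReal.ofReal_add hε2.le hε2.le, add_halves]
  refine ⟨ηg, hsub 2 (by norm_num) hC2 (hg.trans hδ1), hsub q hq hCq ?_⟩
  refine (eLpNorm_le_eLpNorm_mul_rpow_measure_univ hq2 ?_).trans ((mul_le_mul_left hg M).trans hδM)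
  exact ((hCf.1.sub (hgcont.memLp_of_hasCompactSupport (p := 2) hgc).1)).restrict

/-- The class in `L²` of a continuous function with compact support. -/
def ccLp (μ : Measure X) [IsFiniteMeasureOnCompacts μ] : C_c(X, ℂ) →ₗ[ℂ] Lp ℂ 2 μ where
  toFun g := (g.continuous.memLp_of_hasCompactSupport g.hasCompactSupport).toLp g
  map_add' _ _ := rfl
  map_smul' _ _ := rfl

variable {μ : Measure X} [IsFiniteMeasureOnCompacts μ]

theorem coeFn_ccLp (g : C_c(X, ℂ)) : ccLp μ g =ᵐ[μ] g :=
  (g.continuous.memLp_of_hasCompactSupport g.hasCompactSupport).coeFn_toLp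

theorem inner_ccLp (g : C_c(X, ℂ)) (f : Lp ℂ 2 μ) :
    ⟪ccLp μ g, f⟫_ℂ = ∫ x, (starRingEnd ℂ) (g x) * f x ∂μ := by
  rw [L2.inner_def]
  refine integral_congr_ae ?_
  filter_upwards [coeFn_ccLp g] with x hx
  rw [hx, RCLike.inner_apply, mul_comm]

theorem inner_ccLp_ccLp (g h : C_c(X, ℂ)) :
    ⟪ccLp μ g, ccLp μ h⟫_ℂ = ∫ x, (starRingEnd ℂ) (g x) * h x ∂μ := by
  rw [inner_ccLp]
  refine integral_congr_ae ?_
  filter_upwards [coeFn_ccLp h] with x hx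
  rw [hx]

theorem denseRange_ccLp [μ.InnerRegularCompactLTTop] : DenseRange (ccLp μ) := by
  refine Metric.denseRange_iff.2 fun f ε hε => ?_
  obtain ⟨g, hg, -⟩ := exists_eLpNorm_sub_le (q := 2) (by norm_num) le_rfl (Lp.memLp f)
    (Lp.memLp f) (half_pos hε)
  refine ⟨g, ?_⟩
  rw [Lp.dist_def]
  have : eLpNorm (⇑f - ⇑(ccLp μ g)) 2 μ = eLpNorm (⇑f - ⇑g) 2 μ :=
    eLpNorm_congr_ae ((ae_eq_refl _).sub (coeFn_ccLp g))
  rw [this]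
  exact (ENNReal.toReal_le_of_le_ofReal (by positivity) hg).trans_lt (half_lt_self hε)

theorem eq_of_forall_inner_ccLp [μ.InnerRegularCompactLTTop] {u v : Lp ℂ 2 μ}
    (h : ∀ k : C_c(X, ℂ), ⟪ccLp μ k, u⟫_ℂ = ⟪ccLp μ k, v⟫_ℂ) : u = v := by
  have h2 := Continuous.ext_on (denseRange_ccLp (μ := μ)) (f := fun w : Lp ℂ 2 μ => ⟪w, u⟫_ℂ)
    (g := fun w => ⟪w, v⟫_ℂ) (by fun_prop) (by fun_prop) (by rintro _ ⟨k, rfl⟩; exact h k)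
  exact ext_inner_left ℂ fun w => congrFun h2 w

end Density

/-! ### Translation, involution, twisting and convolution on C_c(G) -/

section CompactlySupported

variable {G : Type*} [CommGroup G] [TopologicalSpace G] [IsTopologicalGroup G]

theorem hasCompactSupport_inv_mul (x : G) (g : C_c(G, ℂ)) :
    HasCompactSupport fun y => g (x⁻¹ * y) :=
  g.hasCompactSupport.comp_homeomorph (Homeomorph.mulLeft x⁻¹)

/-- The translate `y ↦ g (x⁻¹ y)`. -/
def ccTranslate (x : G) (g : C_c(G, ℂ)) : C_c(G, ℂ) :=
  ⟨⟨fun y => g (x⁻¹ * y), by fun_prop⟩, hasCompactSupport_inv_mul x g⟩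

@[simp] theorem ccTranslate_apply (x : G) (g : C_c(G, ℂ)) (y : G) :
    ccTranslate x g y = g (x⁻¹ * y) := rfl

/-- The involution `g*(x) = conj (g (x⁻¹))`. -/
def ccStar (g : C_c(G, ℂ)) : C_c(G, ℂ) :=
  ⟨⟨fun y => (starRingEnd ℂ) (g y⁻¹), by fun_prop⟩,
    (g.hasCompactSupport.comp_homeomorph (Homeomorph.inv G)).comp_left (map_zero _)⟩

@[simp] theorem ccStar_apply (g : C_c(G, ℂ)) (y : G) :
    ccStar g y = (starRingEnd ℂ) (g y⁻¹) := rfl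

/-- The product of `g` with a character. -/
def ccTwist (η : PontryaginDual G) (g : C_c(G, ℂ)) : C_c(G, ℂ) :=
  ⟨⟨fun y => (η y : ℂ) * g y, by
    have := map_continuous η
    fun_prop⟩, g.hasCompactSupport.mul_left⟩

@[simp] theorem ccTwist_apply (η : PontryaginDual G) (g : C_c(G, ℂ)) (y : G) :
    ccTwist η g y = (η y : ℂ) * g y := rfl

variable [MeasurableSpace G] [BorelSpace G]

/-- On C_c any Haar measure is a multiple of `Measure.haar`, which is inversion invariant. The
uniqueness theorem is applied to real and imaginary parts. -/
theorem integral_inv_of_hasCompactSupport [LocallyCompactSpace G] (θ : Measure G)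
    [θ.IsHaarMeasure] (f : C_c(G, ℂ)) :
    ∫ x, f x⁻¹ ∂θ = ∫ x, f x ∂θ := by
  have key : ∀ h : C_c(G, ℂ), ∫ x, h x ∂θ =
      Measure.haarScalarFactor θ Measure.haar • ∫ x, h x ∂(Measure.haar : Measure G) := by
    intro h
    have hre := Measure.integral_isMulLeftInvariant_eq_smul_of_hasCompactSupport θ Measure.haar
      (f := fun x => (h x).re) (by fun_prop)
      (h.hasCompactSupport.comp_left (g := Complex.re) rfl)
    have him := Measure.integral_isMulLeftInvariant_eq_smul_of_hasCompactSupport θ Measure.haar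
      (f := fun x => (h x).im) (by fun_prop)
      (h.hasCompactSupport.comp_left (g := Complex.im) rfl)
    rw [integral_smul_nnreal_measure] at hre him
    have e1 : ∀ (ν : Measure G) [IsFiniteMeasureOnCompacts ν],
        ∫ x, (h x).re ∂ν = (∫ x, h x ∂ν).re := fun ν _ =>
      Complex.reCLM.integral_comp_comm h.integrable
    have e2 : ∀ (ν : Measure G) [IsFiniteMeasureOnCompacts ν],
        ∫ x, (h x).im ∂ν = (∫ x, h x ∂ν).im := fun ν _ =>
      Complex.imCLM.integral_comp_comm h.integrable
    rw [e1, e1] at hre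
    rw [e2, e2] at him
    apply Complex.ext
    · rw [hre, NNReal.smul_def, NNReal.smul_def, Complex.real_smul, Complex.re_ofReal_mul,
        smul_eq_mul]
    · rw [him, NNReal.smul_def, NNReal.smul_def, Complex.real_smul, Complex.im_ofReal_mul,
        smul_eq_mul]
  let fi : C_c(G, ℂ) := ⟨⟨fun x => f x⁻¹, by fun_prop⟩,
    f.hasCompactSupport.comp_homeomorph (Homeomorph.inv G)⟩
  have := key fi
  rw [key f]
  refine this.trans ?_
  congr 1
  exact integral_inv_eq_self (fun x => f x) Measure.haar

theorem integral_div_left_of_hasCompactSupport [LocallyCompactSpace G] (θ : Measure G)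
    [θ.IsHaarMeasure] (f : C_c(G, ℂ)) (y : G) :
    ∫ x, f (y * x⁻¹) ∂θ = ∫ x, f x ∂θ := by
  have := integral_inv_of_hasCompactSupport θ (ccTranslate y⁻¹ f)
  simp only [ccTranslate_apply, inv_inv] at this
  rw [this, integral_mul_left_eq_self]

section Convolution

variable (θ : Measure G) [θ.IsHaarMeasure]

theorem integrable_cc_smul {V : Type*} [NormedAddCommGroup V] [NormedSpace ℂ V]
    (g : C_c(G, ℂ)) {u : G → V} (hu : Continuous u) : Integrable (fun x => g x • u x) θ := by
  have := g.continuous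
  exact Continuous.integrable_of_hasCompactSupport (by fun_prop) g.hasCompactSupport.smul_right

theorem tendsto_integral_norm_translate_sub (g : C_c(G, ℂ)) [LocallyCompactSpace G] (y : G) :
    Filter.Tendsto (fun x => ∫ z, ‖ccTranslate x g z - ccTranslate y g z‖ ∂θ) (𝓝 y) (𝓝 0) := by
  obtain ⟨K, hK, hyK⟩ := exists_compact_mem_nhds y
  have hc : ContinuousOn (fun x => ∫ z, ‖ccTranslate x g z - ccTranslate y g z‖ ∂θ) K := by
    refine continuousOn_integral_of_compact_support (k := K * tsupport g)
      (hK.mul g.hasCompactSupport.isCompact)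
      (f := fun x z => ‖ccTranslate x g z - ccTranslate y g z‖) ?_ ?_
    · have := g.continuous
      simp only [Function.uncurry_def, ccTranslate_apply]
      fun_prop
    · intro x z hx hz
      have h0 : ∀ w ∈ K, g (w⁻¹ * z) = 0 := fun w hw =>
        image_eq_zero_of_notMem_tsupport fun h => hz ⟨w, hw, w⁻¹ * z, h, by simp⟩
      simp [h0 x hx, h0 y (mem_of_mem_nhds hyK)]
  have := (hc.continuousAt hyK).tendsto
  simpa using this

theorem conv_eq_zero (g h : C_c(G, ℂ)) {y : G} (hy : y ∉ tsupport g * tsupport h) (x : G) :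
    g x * h (x⁻¹ * y) = 0 := by
  by_cases hx : x ∈ tsupport g
  · have : x⁻¹ * y ∉ tsupport h := fun h' => hy ⟨x, hx, x⁻¹ * y, h', by simp⟩
    rw [image_eq_zero_of_notMem_tsupport this, mul_zero]
  · rw [image_eq_zero_of_notMem_tsupport hx, zero_mul]

/-- The convolution of two compactly supported continuous functions. -/
def ccConv [T2Space G] (g h : C_c(G, ℂ)) : C_c(G, ℂ) :=
  ⟨⟨fun y => ∫ x, g x * h (x⁻¹ * y) ∂θ, by
    rw [← continuousOn_univ]
    refine continuousOn_integral_of_compact_support (k := tsupport g) g.hasCompactSupport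
      (f := fun y x => g x * h (x⁻¹ * y)) (by fun_prop) fun y x _ hx => ?_
    rw [image_eq_zero_of_notMem_tsupport hx, zero_mul]⟩,
   HasCompactSupport.intro (g.hasCompactSupport.isCompact.mul h.hasCompactSupport.isCompact)
    fun y hy => by simp [conv_eq_zero g h hy]⟩

variable [T2Space G]

theorem ccConv_apply (g h : C_c(G, ℂ)) (y : G) :
    ccConv θ g h y = ∫ x, g x * h (x⁻¹ * y) ∂θ := rfl

theorem ccConv_comm [LocallyCompactSpace G] (g h : C_c(G, ℂ)) :
    ccConv θ g h = ccConv θ h g := by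
  ext y
  rw [ccConv_apply, ccConv_apply]
  let k : C_c(G, ℂ) := ⟨⟨fun x => g x * h (x⁻¹ * y), by fun_prop⟩, g.hasCompactSupport.mul_right⟩
  have := integral_div_left_of_hasCompactSupport θ k y
  refine this.symm.trans (integral_congr_ae (.of_forall fun x => ?_))
  change g (y * x⁻¹) * h ((y * x⁻¹)⁻¹ * y) = _
  rw [mul_comm]
  congr 2
  · simp
  · rw [mul_comm]

theorem ccConv_twist (η : PontryaginDual G) (g h : C_c(G, ℂ)) :
    ccConv θ (ccTwist η g) (ccTwist η h) = ccTwist η (ccConv θ g h) := by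
  ext y
  rw [ccTwist_apply, ccConv_apply, ccConv_apply, ← integral_const_mul]
  refine integral_congr_ae (.of_forall fun x => ?_)
  have : (η y : ℂ) = η x * η (x⁻¹ * y) := by
    rw [← Circle.coe_mul, ← map_mul, mul_inv_cancel_left]
  simp only [ccTwist_apply, this]
  ring

/-- Integration against a convolution. -/
theorem integral_ccConv_smul {V : Type*} [NormedAddCommGroup V] [NormedSpace ℂ V] [CompleteSpace V]
    (g h : C_c(G, ℂ)) {u : G → V} (hu : Continuous u) :
    ∫ y, ccConv θ g h y • u y ∂θ = ∫ x, g x • ∫ y, h y • u (x * y) ∂θ ∂θ := by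
  have h1 : ∀ x, g x • ∫ y, h y • u (x * y) ∂θ = ∫ y, (g x * h (x⁻¹ * y)) • u y ∂θ := by
    intro x
    rw [← integral_mul_left_eq_self (fun y => (g x * h (x⁻¹ * y)) • u y) x, ← integral_smul]
    simp [mul_smul]
  simp_rw [h1]
  rw [integral_integral_swap_of_hasCompactSupport]
  · refine integral_congr_ae (.of_forall fun y => ?_)
    simp only [ccConv_apply]
    rw [integral_smul_const]
  · have h1 := g.continuous
    have h2 := h.continuous
    simp only [Function.uncurry_def]
    fun_prop
  · refine HasCompactSupport.intro (K := tsupport g ×ˢ (tsupport g * tsupport h))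
      (g.hasCompactSupport.isCompact.prod
        (g.hasCompactSupport.isCompact.mul h.hasCompactSupport.isCompact)) ?_
    rintro ⟨x, y⟩ hxy
    rw [Set.mem_prod, not_and_or] at hxy
    rcases hxy with hx | hy
    · simp [image_eq_zero_of_notMem_tsupport hx]
    · simp [conv_eq_zero g h hy]

end Convolution

end CompactlySupported

/-! ### Characters of an algebra containing a covariant pair -/

section Covariant

variable {G : Type*} [CommGroup G] [TopologicalSpace G] [IsTopologicalGroup G]
  [MeasurableSpace G] [BorelSpace G] (θ : Measure G) [θ.IsHaarMeasure]

/-- A character of a commutative C⋆-algebra containing a covariant pair of representations of `G`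
and of the compactly supported continuous functions on `G` is either zero on the latter or given by
a character of `G`. -/
theorem exists_character_of_covariant {A : Type*} [CommCStarAlgebra A] (U : G →* A)
    (T : C_c(G, ℂ) → A) (hUs : ∀ x, star (U x) = U x⁻¹)
    (hUT : ∀ x g, U x * T g = T (ccTranslate x g))
    (hT : ∀ g, Continuous fun x => T (ccTranslate x g))
    (hTT : ∀ g h, T g * T h = ∫ x, g x • T (ccTranslate x h) ∂θ)
    (φ : WeakDual.characterSpace ℂ A) {h : C_c(G, ℂ)} (hh : φ (T h) ≠ 0) :
    ∃ χ : PontryaginDual G, ∀ g, φ (T g) = fourierInt θ g χ := by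
  have hφs : ∀ x, φ (U x⁻¹) = (starRingEnd ℂ) (φ (U x)) := fun x => by
    rw [← hUs, map_star]; rfl
  have hnorm : ∀ x, ‖φ (U x)‖ = 1 := fun x => by
    have h1 : φ (U x) * (starRingEnd ℂ) (φ (U x)) = 1 := by
      rw [← hφs, ← map_mul, ← map_mul, mul_inv_cancel, map_one, map_one]
    rw [Complex.mul_conj, Complex.normSq_eq_norm_sq] at h1
    have h2 : ‖φ (U x)‖ ^ 2 = 1 := by exact_mod_cast h1
    exact (pow_eq_one_iff_of_nonneg (norm_nonneg _) two_ne_zero).1 h2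
  have hφc : Continuous φ := map_continuous φ
  have hUc : Continuous fun x => φ (U x) := by
    -- `U` itself need not be norm continuous; continuity of `φ ∘ U` comes from that of `x ↦ T
    -- (ccTranslate x h)`, after division by `φ (T h) ≠ 0`.
    have : (fun x => φ (U x)) = fun x => φ (T (ccTranslate x h)) / φ (T h) := by
      ext x
      rw [← hUT, map_mul, mul_div_cancel_right₀ _ hh]
    rw [this]
    exact (hφc.comp (hT h)).div_const _
  -- The inverse in `U x⁻¹` matches the conjugate of `χ` in `fourierInt`.
  let χ : G →ₜ* Circle :=
    { toFun := fun x => ⟨φ (U x⁻¹), mem_sphere_zero_iff_norm.2 (hnorm _)⟩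
      map_one' := Circle.ext (by simp)
      map_mul' := fun x y => Circle.ext (by
        change φ (U (x * y)⁻¹) = φ (U x⁻¹) * φ (U y⁻¹)
        rw [mul_inv, map_mul, map_mul])
      continuous_toFun := (hUc.comp continuous_inv).subtype_mk _ }
  refine ⟨χ, fun g => ?_⟩
  have hχ : ∀ x, (starRingEnd ℂ) ((χ x : Circle) : ℂ) = φ (U x) := fun x => by
    change (starRingEnd ℂ) (φ (U x⁻¹)) = _
    rw [← hφs, inv_inv]
  have key : φ (T g) * φ (T h) = fourierInt θ g χ * φ (T h) := by
    change _ = (∫ x, g x * (starRingEnd ℂ) ((χ x : Circle) : ℂ) ∂θ) * φ (T h)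
    rw [← map_mul, hTT, ← integral_mul_const]
    refine ((WeakDual.CharacterSpace.toCLM φ).integral_comp_comm
      (integrable_cc_smul θ g (hT h))).symm.trans ?_
    refine integral_congr_ae (.of_forall fun x => ?_)
    change φ (g x • T (ccTranslate x h)) = g x * (starRingEnd ℂ) ((χ x : Circle) : ℂ) * φ (T h)
    rw [map_smul, ← hUT, map_mul, hχ, smul_eq_mul, mul_assoc]
  exact mul_right_cancel₀ hh key

end Covariant

/-! ### Convolution operators on L²(G) and their norm -/

section ConvolutionOperators

variable {G : Type*} [CommGroup G] [TopologicalSpace G] [IsTopologicalGroup G]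
  [LocallyCompactSpace G] [T2Space G] [MeasurableSpace G] [BorelSpace G]
  (θ : Measure G) [θ.IsHaarMeasure]

/-- Translation by `x` on `L²(G)`. -/
def translationₗᵢ (x : G) : Lp ℂ 2 θ →ₗᵢ[ℂ] Lp ℂ 2 θ where
  toFun v := DomMulAct.mk x⁻¹ • v
  map_add' u v := DomMulAct.smul_Lp_add _ u v
  map_smul' c v := smul_comm _ c v
  norm_map' v := DomMulAct.norm_smul_Lp _ v

/-- Translation by `x` on `L²(G)`, as a bounded operator. -/
def translation (x : G) : Lp ℂ 2 θ →L[ℂ] Lp ℂ 2 θ :=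
  (translationₗᵢ θ x).toContinuousLinearMap

theorem translation_apply (x : G) (v : Lp ℂ 2 θ) :
    translation θ x v = DomMulAct.mk x⁻¹ • v := rfl

theorem norm_translation_apply (x : G) (v : Lp ℂ 2 θ) : ‖translation θ x v‖ = ‖v‖ :=
  (translationₗᵢ θ x).norm_map v

theorem inner_translation_translation (x : G) (u v : Lp ℂ 2 θ) :
    ⟪translation θ x u, translation θ x v⟫_ℂ = ⟪u, v⟫_ℂ :=
  (translationₗᵢ θ x).inner_map_map u v

theorem translation_mul (x y : G) :
    translation θ (x * y) = translation θ x * translation θ y := by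
  ext1 v
  rw [mul_apply_eq_comp, translation_apply, translation_apply, translation_apply,
    ← mul_smul]
  congr 1
  rw [mul_inv_rev, DomMulAct.mk_mul]

theorem translation_one : translation θ (1 : G) = 1 := by
  ext1 v
  rw [translation_apply, inv_one, DomMulAct.mk_one, one_smul, one_apply_eq_self]

theorem translation_mul_inv (x : G) : translation θ x * translation θ x⁻¹ = 1 := by
  rw [← translation_mul, mul_inv_cancel, translation_one]

theorem inner_translation_left (x : G) (u v : Lp ℂ 2 θ) :
    ⟪translation θ x u, v⟫_ℂ = ⟪u, translation θ x⁻¹ v⟫_ℂ := by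
  rw [← inner_translation_translation θ x u, ← mul_apply_eq_comp,
    translation_mul_inv, one_apply_eq_self]

theorem star_translation (x : G) : star (translation θ x) = translation θ x⁻¹ := by
  rw [ContinuousLinearMap.star_eq_adjoint]
  refine ((ContinuousLinearMap.eq_adjoint_iff _ _).2 fun u v => ?_).symm
  rw [inner_translation_left, inv_inv]

theorem translation_ccLp (x : G) (g : C_c(G, ℂ)) :
    translation θ x (ccLp θ g) = ccLp θ (ccTranslate x g) := rfl

theorem continuous_translation_apply [θ.InnerRegularCompactLTTop] (v : Lp ℂ 2 θ) :
    Continuous fun x => translation θ x v := by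
  have : Fact ((2 : ℝ≥0∞) ≠ ∞) := ⟨by simp⟩
  have h : Continuous fun x : G => DomMulAct.mk x⁻¹ :=
    DomMulAct.continuous_mk.comp continuous_inv
  exact h.smul continuous_const

theorem norm_integral_smul_translation_le (g : C_c(G, ℂ)) (v : Lp ℂ 2 θ) :
    ‖∫ x, g x • translation θ x v ∂θ‖ ≤ (∫ x, ‖g x‖ ∂θ) * ‖v‖ := by
  rw [← integral_mul_const]
  refine norm_integral_le_of_norm_le (g.integrable.norm.mul_const _) (.of_forall fun x => ?_)
  rw [norm_smul, norm_translation_apply]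

variable [θ.InnerRegularCompactLTTop]

/-- The operator of convolution with a compactly supported continuous function. -/
def convOp : C_c(G, ℂ) →ₗ[ℂ] (Lp ℂ 2 θ →L[ℂ] Lp ℂ 2 θ) where
  toFun g := LinearMap.mkContinuous
    { toFun := fun v => ∫ x, g x • translation θ x v ∂θ
      map_add' := fun u v => by
        simp only [map_add, smul_add]
        exact integral_add (integrable_cc_smul θ g (continuous_translation_apply θ u))
          (integrable_cc_smul θ g (continuous_translation_apply θ v))
      map_smul' := fun c v => by
        simp only [map_smul, smul_comm (g _) c, RingHom.id_apply]
        exact integral_smul _ _ }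
    (∫ x, ‖g x‖ ∂θ) fun v => norm_integral_smul_translation_le θ g v
  map_add' g h := by
    ext1 v
    refine (integral_congr_ae (.of_forall fun x => ?_)).trans
      (integral_add (integrable_cc_smul θ g (continuous_translation_apply θ v))
        (integrable_cc_smul θ h (continuous_translation_apply θ v)))
    exact add_smul _ _ _
  map_smul' c g := by
    ext1 v
    refine (integral_congr_ae (.of_forall fun x => ?_)).trans (integral_smul c _)
    exact mul_smul c (g x) _

theorem convOp_apply (g : C_c(G, ℂ)) (v : Lp ℂ 2 θ) :
    convOp θ g v = ∫ x, g x • translation θ x v ∂θ := rfl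

theorem norm_convOp_le (g : C_c(G, ℂ)) : ‖convOp θ g‖ ≤ ∫ x, ‖g x‖ ∂θ :=
  ContinuousLinearMap.opNorm_le_bound _ (integral_nonneg fun _ => norm_nonneg _)
    (norm_integral_smul_translation_le θ g)

theorem translation_mul_convOp (x : G) (g : C_c(G, ℂ)) :
    translation θ x * convOp θ g = convOp θ (ccTranslate x g) := by
  ext1 v
  rw [mul_apply_eq_comp, convOp_apply, convOp_apply,
    ← ContinuousLinearMap.integral_comp_comm _
      (integrable_cc_smul θ g (continuous_translation_apply θ v)),
    ← integral_mul_left_eq_self (fun z => ccTranslate x g z • translation θ z v) x]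
  simp only [map_smul, ccTranslate_apply, inv_mul_cancel_left, translation_mul,
    mul_apply_eq_comp]

theorem convOp_ccConv (g h : C_c(G, ℂ)) :
    convOp θ (ccConv θ g h) = convOp θ g * convOp θ h := by
  ext1 v
  refine (integral_ccConv_smul θ g h (continuous_translation_apply θ v)).trans ?_
  rw [mul_apply_eq_comp, convOp_apply]
  refine integral_congr_ae (.of_forall fun x => ?_)
  simp only
  congr 1
  rw [convOp_apply, ← ContinuousLinearMap.integral_comp_comm _
      (integrable_cc_smul θ h (continuous_translation_apply θ v))]
  simp only [map_smul, translation_mul, mul_apply_eq_comp]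
  rfl

/-- The left side is a Bochner integral in L², the right a pointwise convolution; they are compared
by pairing with C_c, where `integral_ccConv_smul` applies. -/
theorem convOp_ccLp (g h : C_c(G, ℂ)) : convOp θ g (ccLp θ h) = ccLp θ (ccConv θ g h) := by
  refine eq_of_forall_inner_ccLp fun k => ?_
  have hk : Continuous fun y => (starRingEnd ℂ) (k y) := by fun_prop
  rw [inner_ccLp_ccLp, convOp_apply,
    ← integral_inner (integrable_cc_smul θ g (continuous_translation_apply θ _))]
  simp_rw [mul_comm ((starRingEnd ℂ) (k _)), ← smul_eq_mul (_ : ℂ) ((starRingEnd ℂ) (k _))]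
  rw [integral_ccConv_smul θ g h hk]
  refine integral_congr_ae (.of_forall fun x => ?_)
  simp only
  rw [inner_smul_right, translation_ccLp, inner_ccLp_ccLp, smul_eq_mul]
  congr 1
  rw [← integral_mul_left_eq_self _ x]
  simp [mul_comm]

theorem inner_convOp_ccStar (g : C_c(G, ℂ)) (u v : Lp ℂ 2 θ) :
    ⟪convOp θ (ccStar g) u, v⟫_ℂ = ⟪u, convOp θ g v⟫_ℂ := by
  rw [← inner_conj_symm, convOp_apply, convOp_apply,
    ← integral_inner (integrable_cc_smul θ _ (continuous_translation_apply θ _)),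
    ← integral_inner (integrable_cc_smul θ _ (continuous_translation_apply θ _)), ← integral_conj]
  have hc := continuous_translation_apply θ v
  let f : C_c(G, ℂ) := ⟨⟨fun x => g x * ⟪u, translation θ x v⟫_ℂ, by fun_prop⟩,
    g.hasCompactSupport.mul_right⟩
  have := integral_inv_of_hasCompactSupport θ f
  simp_rw [inner_smul_right]
  refine Eq.trans ?_ this
  refine integral_congr_ae (.of_forall fun x => ?_)
  change _ = g x⁻¹ * ⟪u, translation θ x⁻¹ v⟫_ℂ
  rw [← inner_translation_left]
  simp

/-- Continuity in operator norm, by the L¹ bound on `convOp`; translations alone are only known to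
be strongly continuous. -/
theorem continuous_convOp_ccTranslate (h : C_c(G, ℂ)) :
    Continuous fun x => convOp θ (ccTranslate x h) := by
  refine continuous_iff_continuousAt.2 fun y => tendsto_iff_norm_sub_tendsto_zero.2 ?_
  refine squeeze_zero (fun _ => norm_nonneg _) (fun x => ?_)
    (tendsto_integral_norm_translate_sub θ h y)
  rw [← map_sub]
  exact norm_convOp_le θ _

theorem convOp_mul_convOp (g h : C_c(G, ℂ)) :
    convOp θ g * convOp θ h = ∫ x, g x • convOp θ (ccTranslate x h) ∂θ := by
  ext1 v
  rw [ContinuousLinearMap.integral_apply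
    (integrable_cc_smul θ g (continuous_convOp_ccTranslate θ h)), mul_apply_eq_comp,
    convOp_apply]
  refine integral_congr_ae (.of_forall fun x => ?_)
  simp [← translation_mul_convOp]

/-- The bicommutant of the translations. -/
def translationAlgebra : StarSubalgebra ℂ (Lp ℂ 2 θ →L[ℂ] Lp ℂ 2 θ) :=
  StarSubalgebra.centralizer ℂ
    (StarSubalgebra.centralizer ℂ (Set.range (translation θ)) : Set (Lp ℂ 2 θ →L[ℂ] Lp ℂ 2 θ))

omit [θ.InnerRegularCompactLTTop] in
theorem star_mem_range_translation :
    star (Set.range (translation θ)) = Set.range (translation θ) := by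
  ext a
  constructor
  · rintro ⟨x, hx⟩
    exact ⟨x⁻¹, by rw [← star_translation, hx, star_star]⟩
  · rintro ⟨x, rfl⟩
    exact ⟨x⁻¹, by rw [star_translation]⟩

theorem coe_translationAlgebra : (translationAlgebra θ : Set (Lp ℂ 2 θ →L[ℂ] Lp ℂ 2 θ)) =
    (Set.range (translation θ)).centralizer.centralizer := by
  rw [translationAlgebra, StarSubalgebra.coe_centralizer_centralizer, star_mem_range_translation,
    Set.union_self]

theorem translation_mem (x : G) : translation θ x ∈ translationAlgebra θ := by
  rw [← SetLike.mem_coe, coe_translationAlgebra]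
  exact Set.subset_centralizer_centralizer ⟨x, rfl⟩

/-- An operator commuting with all translations commutes with their integrals. This is why the
bicommutant is used: it is norm closed, commutative, and contains both translations and
convolutions. -/
theorem convOp_mem (g : C_c(G, ℂ)) : convOp θ g ∈ translationAlgebra θ := by
  rw [← SetLike.mem_coe, coe_translationAlgebra]
  intro B hB
  ext1 v
  rw [mul_apply_eq_comp, mul_apply_eq_comp, convOp_apply, convOp_apply,
    ← ContinuousLinearMap.integral_comp_comm _
      (integrable_cc_smul θ g (continuous_translation_apply θ v))]
  refine integral_congr_ae (.of_forall fun x => ?_)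
  have := DFunLike.congr_fun (hB (translation θ x) ⟨x, rfl⟩) v
  simp only [mul_apply_eq_comp] at this
  simp [this]

instance isClosed_translationAlgebra :
    IsClosed (translationAlgebra θ : Set (Lp ℂ 2 θ →L[ℂ] Lp ℂ 2 θ)) := by
  rw [coe_translationAlgebra]
  exact Set.isClosed_centralizer _

instance : CommCStarAlgebra (translationAlgebra θ) :=
  { StarSubalgebra.cstarAlgebra (translationAlgebra θ) with
    mul_comm := fun a b => by
      have ha := a.2
      have hb := b.2
      rw [← SetLike.mem_coe, coe_translationAlgebra] at ha hb
      refine Subtype.ext (Set.centralizer_centralizer_comm_of_comm ?_ _ ha _ hb)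
      rintro _ ⟨x, rfl⟩ _ ⟨y, rfl⟩
      rw [← translation_mul, ← translation_mul, mul_comm] }

theorem exists_character (φ : WeakDual.characterSpace ℂ (translationAlgebra θ)) {h : C_c(G, ℂ)}
    (hh : φ ⟨convOp θ h, convOp_mem θ h⟩ ≠ 0) :
    ∃ χ : PontryaginDual G, ∀ g, φ ⟨convOp θ g, convOp_mem θ g⟩ = fourierInt θ g χ := by
  have hc : ∀ h : C_c(G, ℂ), Continuous fun x => (⟨convOp θ (ccTranslate x h), convOp_mem θ _⟩ :
    translationAlgebra θ) := fun h => (continuous_convOp_ccTranslate θ h).subtype_mk _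
  refine exists_character_of_covariant θ
    { toFun := fun x => ⟨translation θ x, translation_mem θ x⟩
      map_one' := Subtype.ext (translation_one θ)
      map_mul' := fun x y => Subtype.ext (translation_mul θ x y) }
    (fun g => ⟨convOp θ g, convOp_mem θ g⟩)
    (fun x => Subtype.ext (star_translation θ x))
    (fun x g => Subtype.ext (translation_mul_convOp θ x g)) hc
    (fun g h => Subtype.ext ?_) φ hh
  exact (convOp_mul_convOp θ g h).trans
    ((translationAlgebra θ).toSubmodule.subtypeL.integral_comp_comm
      (integrable_cc_smul θ g (hc h)))

/-- The Gelfand transform is isometric, and a character of the algebra takes `convOp θ g` either to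
0 or to a value of ĝ. -/
theorem norm_convOp_le_of_forall (g : C_c(G, ℂ)) {C : ℝ} (hC : 0 ≤ C)
    (h : ∀ χ, ‖fourierInt θ g χ‖ ≤ C) : ‖convOp θ g‖ ≤ C := by
  let a : translationAlgebra θ := ⟨convOp θ g, convOp_mem θ g⟩
  change ‖a‖ ≤ C
  rw [← (AddMonoidHomClass.isometry_iff_norm _).1
    (gelfandTransform_isometry (translationAlgebra θ)) a, ContinuousMap.norm_le _ hC]
  intro φ
  change ‖φ a‖ ≤ C
  by_cases h0 : φ a = 0
  · simpa [h0] using hC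
  · obtain ⟨χ, hχ⟩ := exists_character θ φ h0
    rw [hχ g]
    exact h χ

end ConvolutionOperators

/-! ### The Fourier transform on C_c(G) -/

section FourierTransform

variable {G : Type*} [CommGroup G] [TopologicalSpace G] [IsTopologicalGroup G]
  [LocallyCompactSpace G]

theorem dist_circle (z w : Circle) : dist z w = ‖(z : ℂ) - w‖ := dist_eq_norm (z : ℂ) (w : ℂ)

instance : ContinuousEval (PontryaginDual G) G Circle :=
  inferInstanceAs (ContinuousEval (G →ₜ* Circle) G Circle)

theorem continuous_dual_eval : Continuous fun p : PontryaginDual G × G => ((p.1 p.2 : Circle) : ℂ) :=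
  continuous_subtype_val.comp continuous_eval

/-- A family of characters with a common modulus of continuity at `1` is relatively compact. -/
theorem isCompact_setOf_modulus {ω : G → ℝ} (hω : Filter.Tendsto ω (𝓝 1) (𝓝 0)) :
    IsCompact {χ : PontryaginDual G | ∀ x, dist (χ x) 1 ≤ ω x} := by
  let S : Set (G →ₜ* Circle) := {χ | ∀ x, dist (χ x) 1 ≤ ω x}
  change IsCompact S
  rw [(ContinuousMonoidHom.isInducing_toContinuousMap G Circle).isCompact_iff]
  have hmod : ∀ (f : G →* Circle), (∀ x, dist (f x) 1 ≤ ω x) → ∀ y x, dist (f y) (f x) ≤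
      ω (y * x⁻¹) := by
    intro f hf y x
    refine le_trans (le_of_eq ?_) (hf (y * x⁻¹))
    rw [map_mul, map_inv, ← div_eq_mul_inv]
    rw [dist_circle, dist_circle]
    have : ((f y / f x : Circle) : ℂ) - ((1 : Circle) : ℂ) = (f y - f x) * (f x : ℂ)⁻¹ := by
      rw [Circle.coe_div, Circle.coe_one, sub_mul, mul_inv_cancel₀ (Circle.coe_ne_zero _),
        div_eq_mul_inv]
    rw [this, norm_mul, norm_inv, Circle.norm_coe, inv_one, mul_one]
  have hω' : ∀ x, Filter.Tendsto (fun y => ω (x * y⁻¹)) (𝓝 x) (𝓝 0) := fun x => by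
    refine hω.comp ?_
    have : Continuous fun y => x * y⁻¹ := by fun_prop
    simpa using this.tendsto x
  apply ArzelaAscoli.isCompact_of_equicontinuous
  -- In the compact product of circles, being a homomorphism and obeying the modulus are closed
  -- conditions; the modulus makes such homomorphisms continuous.
  · have himg : ContinuousMap.toFun '' ((ContinuousMonoidHom.toContinuousMap :
        (G →ₜ* Circle) → C(G, Circle)) '' S) =
        Set.range ((↑) : (G →* Circle) → (G → Circle)) ∩ {f | ∀ x, dist (f x) 1 ≤ ω x} := by
      ext f
      constructor
      · rintro ⟨_, ⟨χ, hχ, rfl⟩, rfl⟩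
        exact ⟨⟨χ.toMonoidHom, rfl⟩, hχ⟩
      · rintro ⟨⟨f, rfl⟩, hf⟩
        have hc : Continuous f := continuous_iff_continuousAt.2 fun x =>
          tendsto_iff_dist_tendsto_zero.2 (squeeze_zero (fun _ => dist_nonneg)
            (fun y => (dist_comm _ _).trans_le (hmod f hf x y)) (hω' x))
        exact ⟨_, ⟨⟨f, hc⟩, hf, rfl⟩, rfl⟩
    rw [himg]
    refine ((MonoidHom.isClosed_range_coe G Circle).inter ?_).isCompact
    have : {f : G → Circle | ∀ x, dist (f x) 1 ≤ ω x} =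
        ⋂ x, {f : G → Circle | dist (f x) 1 ≤ ω x} := by ext; simp
    rw [this]
    exact isClosed_iInter fun x => isClosed_le (by fun_prop) continuous_const
  · intro x
    refine Metric.equicontinuousAt_of_continuity_modulus _ (hω' x) _ (.of_forall fun y f => ?_)
    obtain ⟨_, χ, hχ, rfl⟩ := f
    exact hmod χ.toMonoidHom hχ x y

variable [MeasurableSpace G] [BorelSpace G] (θ : Measure G) [θ.IsHaarMeasure]

omit [LocallyCompactSpace G] in
theorem integrable_fourierInt (g : C_c(G, ℂ)) (χ : PontryaginDual G) :
    Integrable (fun x => g x * (starRingEnd ℂ) (χ x : ℂ)) θ := by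
  have hχ := map_continuous χ
  have := integrable_cc_smul θ g (u := fun x => (starRingEnd ℂ) (χ x : ℂ)) (by fun_prop)
  simpa using this

omit [LocallyCompactSpace G] in
theorem fourierInt_add (g h : C_c(G, ℂ)) (χ : PontryaginDual G) :
    fourierInt θ ⇑(g + h) χ = fourierInt θ g χ + fourierInt θ h χ := by
  refine Eq.trans ?_ (integral_add (integrable_fourierInt θ g χ) (integrable_fourierInt θ h χ))
  refine integral_congr_ae (.of_forall fun x => ?_)
  simp [add_mul]

omit [LocallyCompactSpace G] in
theorem fourierInt_smul (c : ℂ) (g : C_c(G, ℂ)) (χ : PontryaginDual G) :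
    fourierInt θ ⇑(c • g) χ = c * fourierInt θ g χ := by
  refine Eq.trans ?_ (integral_const_mul _ _)
  refine integral_congr_ae (.of_forall fun x => ?_)
  simp [mul_assoc]

omit [LocallyCompactSpace G] in
theorem norm_fourierInt_le (f : G → ℂ) (χ : PontryaginDual G) :
    ‖fourierInt θ f χ‖ ≤ ∫ x, ‖f x‖ ∂θ := by
  refine (norm_integral_le_integral_norm _).trans_eq (integral_congr_ae (.of_forall fun x => ?_))
  simp [Circle.norm_coe]

omit [LocallyCompactSpace G] in
theorem fourierInt_translate (x : G) (g : C_c(G, ℂ)) (χ : PontryaginDual G) :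
    fourierInt θ (ccTranslate x g) χ = (starRingEnd ℂ) (χ x : ℂ) * fourierInt θ g χ := by
  rw [fourierInt, ← integral_mul_left_eq_self _ x, fourierInt, ← integral_const_mul]
  refine integral_congr_ae (.of_forall fun y => ?_)
  simp only [ccTranslate_apply, inv_mul_cancel_left, map_mul, Circle.coe_mul]
  ring

omit [LocallyCompactSpace G] in
theorem fourierInt_twist (η : PontryaginDual G) (g : C_c(G, ℂ)) (χ : PontryaginDual G) :
    fourierInt θ (ccTwist η g) χ = fourierInt θ g (η⁻¹ * χ) := by
  refine integral_congr_ae (.of_forall fun y => ?_)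
  have : (η⁻¹ * χ) y = (η y)⁻¹ * χ y := rfl
  simp only [ccTwist_apply, this, Circle.coe_mul, Circle.coe_inv_eq_conj, map_mul,
    Complex.conj_conj]
  ring

theorem fourierInt_ccStar (g : C_c(G, ℂ)) (χ : PontryaginDual G) :
    fourierInt θ (ccStar g) χ = (starRingEnd ℂ) (fourierInt θ g χ) := by
  have hχ := map_continuous χ
  rw [fourierInt, fourierInt, ← integral_conj]
  let f : C_c(G, ℂ) := ⟨⟨fun x => (starRingEnd ℂ) (g x) * χ x, by fun_prop⟩,
    (g.hasCompactSupport.comp_left (map_zero (starRingEnd ℂ))).mul_right⟩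
  refine Eq.trans ?_ ((integral_inv_of_hasCompactSupport θ f).trans ?_)
  · refine integral_congr_ae (.of_forall fun y => ?_)
    change (starRingEnd ℂ) (g y⁻¹) * (starRingEnd ℂ) (χ y : ℂ) =
      (starRingEnd ℂ) (g y⁻¹) * (χ y⁻¹ : ℂ)
    rw [map_inv χ, Circle.coe_inv_eq_conj]
  · refine integral_congr_ae (.of_forall fun y => ?_)
    change (starRingEnd ℂ) (g y) * χ y = _
    simp

theorem fourierInt_ccConv [T2Space G] (g h : C_c(G, ℂ)) (χ : PontryaginDual G) :
    fourierInt θ (ccConv θ g h) χ = fourierInt θ g χ * fourierInt θ h χ := by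
  have hχ := map_continuous χ
  have := integral_ccConv_smul θ g h (u := fun x => (starRingEnd ℂ) (χ x : ℂ)) (by fun_prop)
  simp only [smul_eq_mul] at this
  refine Eq.trans this ?_
  rw [fourierInt, ← integral_mul_const]
  refine integral_congr_ae (.of_forall fun x => ?_)
  simp only [map_mul, Circle.coe_mul]
  rw [mul_assoc]
  congr 1
  rw [fourierInt, ← integral_const_mul]
  refine integral_congr_ae (.of_forall fun y => ?_)
  simp only
  ring

theorem continuous_fourierInt (g : C_c(G, ℂ)) : Continuous (fourierInt θ g) := by
  rw [← continuousOn_univ]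
  change ContinuousOn (fun χ : PontryaginDual G => ∫ x, g x * (starRingEnd ℂ) (χ x : ℂ) ∂θ) _
  refine continuousOn_integral_of_compact_support (k := tsupport g) g.hasCompactSupport
    (f := fun (χ : PontryaginDual G) x => g x * (starRingEnd ℂ) (χ x : ℂ)) ?_ fun y x _ hx => ?_
  · have h1 := continuous_dual_eval (G := G)
    have h2 := g.continuous
    simp only [Function.uncurry_def]
    exact Continuous.continuousOn (by fun_prop)
  · rw [image_eq_zero_of_notMem_tsupport hx, zero_mul]

/-- The Riemann-Lebesgue lemma. -/
theorem isCompact_setOf_le_fourierInt (g : C_c(G, ℂ)) {ε : ℝ} (hε : 0 < ε) :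
    IsCompact {χ | ε ≤ ‖fourierInt θ g χ‖} := by
  -- If |ĝ(χ)| ≥ ε, then ε·|χ(x) − 1| is at most the L¹ distance of `g` to its translate by `x⁻¹`.
  -- So all such χ share one modulus of continuity.
  have hω := (tendsto_integral_norm_translate_sub θ g 1).div_const ε
  rw [zero_div] at hω
  have hω' : Filter.Tendsto (fun x => (∫ z, ‖ccTranslate x⁻¹ g z - ccTranslate 1 g z‖ ∂θ) / ε)
      (𝓝 1) (𝓝 0) := by
    refine hω.comp ?_
    simpa using continuous_inv.tendsto (1 : G)
  refine (isCompact_setOf_modulus hω').of_isClosed_subset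
    (isClosed_le continuous_const (continuous_fourierInt θ g).norm) fun χ hχ x => ?_
  rw [le_div_iff₀ hε]
  have hχ' : ε ≤ ‖fourierInt θ g χ‖ := hχ
  calc dist (χ x) 1 * ε ≤ dist (χ x) 1 * ‖fourierInt θ g χ‖ := by gcongr
    _ = ‖fourierInt θ (ccTranslate x⁻¹ g - ccTranslate 1 g : C_c(G, ℂ)) χ‖ := by
      have h1 : fourierInt θ (ccTranslate x⁻¹ g - ccTranslate 1 g : C_c(G, ℂ)) χ =
          fourierInt θ (ccTranslate x⁻¹ g) χ - fourierInt θ (ccTranslate 1 g) χ := by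
        have := fourierInt_add θ (ccTranslate x⁻¹ g - ccTranslate 1 g) (ccTranslate 1 g) χ
        rw [sub_add_cancel] at this
        rw [this, add_sub_cancel_right]
      rw [h1, fourierInt_translate, fourierInt_translate, ← sub_mul, norm_mul]
      congr 1
      rw [dist_circle, map_inv χ, Circle.coe_inv_eq_conj]
      simp
    _ ≤ _ := norm_fourierInt_le θ _ χ

/-- The Fourier transform of a compactly supported continuous function, as a function vanishing at
infinity. -/
def fourierC0 : C_c(G, ℂ) →ₗ[ℂ] C₀(PontryaginDual G, ℂ) where
  toFun g := ⟨⟨fourierInt θ g, continuous_fourierInt θ g⟩, by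
    rw [Metric.tendsto_nhds]
    intro ε hε
    filter_upwards [(isCompact_setOf_le_fourierInt θ g hε).compl_mem_cocompact] with χ hχ
    simpa using hχ⟩
  map_add' g h := by ext χ; exact fourierInt_add θ g h χ
  map_smul' c g := by ext χ; exact fourierInt_smul θ c g χ

theorem fourierC0_ccConv [T2Space G] (g h : C_c(G, ℂ)) :
    fourierC0 θ (ccConv θ g h) = fourierC0 θ g * fourierC0 θ h := by
  ext χ
  exact fourierInt_ccConv θ g h χ

theorem fourierC0_ccStar (g : C_c(G, ℂ)) : fourierC0 θ (ccStar g) = star (fourierC0 θ g) := by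
  ext χ
  exact fourierInt_ccStar θ g χ

/-- On a compact set of characters, some Fourier transform is bounded away from `0`. -/
theorem exists_fourierInt_ne_zero [T2Space G] {K : Set (PontryaginDual G)} (hK : IsCompact K) :
    ∃ g : C_c(G, ℂ), ∀ χ ∈ K, fourierInt θ g χ ≠ 0 := by
  have ho : IsOpen {p : PontryaginDual G × G | ‖((p.1 p.2 : Circle) : ℂ) - 1‖ < 1 / 2} :=
    isOpen_lt (by have := continuous_dual_eval (G := G); fun_prop) continuous_const
  -- All χ in `K` are within 1/2 of 1 on one neighbourhood `V` of the identity. For a bump `g`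
  -- supported in `V`, |ĝ(χ) − ∫g| ≤ ½∫g, so ĝ(χ) ≠ 0.
  obtain ⟨U, V, hU, hV, hKU, h1V, hUV⟩ := generalized_tube_lemma hK (isCompact_singleton (x := (1 : G)))
    ho (by
        rintro ⟨χ, x⟩ ⟨_, hx⟩
        change ‖((χ x : Circle) : ℂ) - 1‖ < 1 / 2
        have hx1 : x = 1 := hx
        rw [hx1, map_one χ]; simp)
  obtain ⟨η, hη1, hηV, hη⟩ := exists_cutoff (isCompact_singleton (x := (1 : G))) hV h1V
  have hηc := η.continuous
  let g : C_c(G, ℂ) := ⟨⟨fun x => (η x : ℂ), by fun_prop⟩,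
    η.hasCompactSupport.comp_left (g := fun r : ℝ => (r : ℂ)) (by simp)⟩
  have hpos : 0 < ∫ x, η x ∂θ := by
    refine hηc.integral_pos_of_hasCompactSupport_nonneg_nonzero η.hasCompactSupport
      (fun x => (hη x).1) (x := 1) ?_
    rw [hη1 rfl]
    exact one_ne_zero
  refine ⟨g, fun χ hχ h0 => ?_⟩
  have hint : fourierInt θ g χ - ((∫ x, η x ∂θ : ℝ) : ℂ) =
      ∫ x, (η x : ℂ) * (starRingEnd ℂ) ((χ x : ℂ) - 1) ∂θ := by
    rw [← integral_complex_ofReal]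
    refine (integral_sub (integrable_fourierInt θ g χ) g.integrable).symm.trans ?_
    refine integral_congr_ae (.of_forall fun x => ?_)
    change (η x : ℂ) * _ - (η x : ℂ) = _
    simp [mul_sub]
  have hle : ‖fourierInt θ g χ - ((∫ x, η x ∂θ : ℝ) : ℂ)‖ ≤ ∫ x, η x * (1 / 2) ∂θ := by
    rw [hint]
    refine norm_integral_le_of_norm_le (η.integrable.mul_const _) (.of_forall fun x => ?_)
    rw [norm_mul, Complex.norm_real, Real.norm_of_nonneg (hη x).1]
    by_cases hx : x ∈ V
    · have := hUV (Set.mk_mem_prod (hKU hχ) hx)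
      rw [RCLike.norm_conj]
      exact mul_le_mul_of_nonneg_left this.le (hη x).1
    · rw [image_eq_zero_of_notMem_tsupport fun h => hx (hηV h)]
      simp
  rw [h0, zero_sub, norm_neg, Complex.norm_real, Real.norm_of_nonneg hpos.le, integral_mul_const]
    at hle
  linarith

/-- Translating `g` multiplies ĝ(χ) by the conjugate of χ(x). If no transform separates the two
characters, dividing by a nonzero ĝ(χ₁) gives χ₁(x) = χ₂(x). -/
theorem exists_fourierInt_separates [T2Space G] {χ₁ χ₂ : PontryaginDual G} (h : χ₁ ≠ χ₂) :
    ∃ g : C_c(G, ℂ), fourierInt θ g χ₁ ≠ fourierInt θ g χ₂ := by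
  by_contra! hall
  obtain ⟨g, hg⟩ := exists_fourierInt_ne_zero θ (isCompact_singleton (x := χ₁))
  refine h (PontryaginDual.ext fun x => ?_)
  have := hall (ccTranslate x g)
  rw [fourierInt_translate, fourierInt_translate, ← hall g] at this
  exact Circle.ext ((starRingEnd ℂ).injective (mul_right_cancel₀ (hg χ₁ rfl) this))

end FourierTransform

/-! ### Functions vanishing at infinity and Stone–Weierstrass -/

section ZeroAtInfty

variable {Y : Type*} [TopologicalSpace Y]

theorem c0_norm_le {f : C₀(Y, ℂ)} {C : ℝ} (hC : 0 ≤ C) : ‖f‖ ≤ C ↔ ∀ y, ‖f y‖ ≤ C := by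
  rw [← ZeroAtInftyContinuousMap.norm_toBCF_eq_norm, BoundedContinuousFunction.norm_le hC]
  rfl

theorem c0_norm_apply_le (f : C₀(Y, ℂ)) (y : Y) : ‖f y‖ ≤ ‖f‖ :=
  (c0_norm_le (norm_nonneg f)).1 le_rfl y

/-- Evaluation at a point, as a continuous functional on `C₀(Y, ℂ)`. -/
def c0Eval (y : Y) : C₀(Y, ℂ) →L[ℂ] ℂ :=
  LinearMap.mkContinuous
    { toFun := fun f => f y
      map_add' := fun _ _ => rfl
      map_smul' := fun _ _ => rfl } 1 fun f => by
    rw [one_mul]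
    exact c0_norm_apply_le f y

theorem c0Eval_apply (y : Y) (f : C₀(Y, ℂ)) : c0Eval y f = f y := rfl

/-- The inclusion of the compactly supported functions in the functions vanishing at infinity. -/
def ccC0 : C_c(Y, ℂ) →ₗ[ℂ] C₀(Y, ℂ) where
  toFun f := ⟨f.toContinuousMap, f.hasCompactSupport.is_zero_at_infty⟩
  map_add' _ _ := rfl
  map_smul' _ _ := rfl

@[simp] theorem ccC0_apply (f : C_c(Y, ℂ)) (y : Y) : ccC0 f y = f y := rfl

theorem isCompact_setOf_le_norm (φ : C₀(Y, ℂ)) {ε : ℝ} (hε : 0 < ε) :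
    IsCompact {y | ε ≤ ‖φ y‖} := by
  have h : ∀ᶠ y in Filter.cocompact Y, ‖φ y‖ < ε := by
    have := (Metric.tendsto_nhds.1 φ.zero_at_infty') ε hε
    filter_upwards [this] with y hy
    simpa using! hy
  obtain ⟨K, hK, hKs⟩ := Filter.mem_cocompact.1 h
  refine hK.of_isClosed_subset (isClosed_le continuous_const φ.continuous.norm) fun y hy => ?_
  by_contra hyK
  have h2 : ‖φ y‖ < ε := hKs hyK
  exact absurd hy (not_le.2 h2)

/-- The product of a compactly supported function with a function vanishing at infinity. -/
def ccMulC0 (f : C_c(Y, ℂ)) (φ : C₀(Y, ℂ)) : C_c(Y, ℂ) :=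
  ⟨⟨fun y => f y * φ y, by fun_prop⟩, f.hasCompactSupport.mul_right⟩

@[simp] theorem ccMulC0_apply (f : C_c(Y, ℂ)) (φ : C₀(Y, ℂ)) (y : Y) :
    ccMulC0 f φ y = f y * φ y := rfl

variable [T2Space Y] [LocallyCompactSpace Y]

/-- A compactly supported function which is `1` on a given compact set and takes values
in `[0, 1]`. -/
theorem exists_cc_cutoff {K : Set Y} (hK : IsCompact K) :
    ∃ ψ : C_c(Y, ℂ), (∀ y ∈ K, ψ y = 1) ∧ ∀ y, ∃ r ∈ Set.Icc (0 : ℝ) 1, ψ y = r := by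
  obtain ⟨η, h1, -, h⟩ := exists_cutoff hK isOpen_univ (Set.subset_univ K)
  have := η.continuous
  exact ⟨⟨⟨fun y => (η y : ℂ), by fun_prop⟩,
    η.hasCompactSupport.comp_left (g := fun r : ℝ => (r : ℂ)) (by simp)⟩,
    fun y hy => by change (η y : ℂ) = 1; rw [h1 hy]; simp, fun y => ⟨η y, h y, rfl⟩⟩

theorem denseRange_ccC0 : DenseRange (ccC0 : C_c(Y, ℂ) →ₗ[ℂ] C₀(Y, ℂ)) := by
  refine Metric.denseRange_iff.2 fun φ ε hε => ?_
  obtain ⟨ψ, h1, h⟩ := exists_cc_cutoff (isCompact_setOf_le_norm φ (half_pos hε))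
  refine ⟨ccMulC0 ψ φ, ?_⟩
  rw [dist_eq_norm]
  refine lt_of_le_of_lt ((c0_norm_le (half_pos hε).le).2 fun y => ?_) (half_lt_self hε)
  change ‖φ y - ψ y * φ y‖ ≤ ε / 2
  by_cases hy : ε / 2 ≤ ‖φ y‖
  · rw [h1 y hy, one_mul, sub_self, norm_zero]
    exact (half_pos hε).le
  · obtain ⟨r, hr, hψ⟩ := h y
    have : φ y - ψ y * φ y = ((1 - r : ℝ) : ℂ) * φ y := by
      rw [hψ]; push_cast; ring
    rw [this, norm_mul, Complex.norm_real, Real.norm_of_nonneg (by linarith [hr.2])]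
    exact (mul_le_of_le_one_left (norm_nonneg _) (by linarith [hr.1])).trans (not_le.1 hy).le

/-- The Stone-Weierstrass theorem for functions vanishing at infinity. -/
theorem dense_of_separates (A : NonUnitalStarSubalgebra ℂ C₀(Y, ℂ))
    (hsep : ∀ y z, y ≠ z → ∃ a ∈ A, a y ≠ a z) (hne : ∀ y, ∃ a ∈ A, a y ≠ 0) :
    Dense (A : Set C₀(Y, ℂ)) := by
  -- The unitization of `A`, seen on the one-point compactification: elements of `A` plus constants.
  -- The compact Stone–Weierstrass theorem applies to it.
  let S : StarSubalgebra ℂ C(OnePoint Y, ℂ) :=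
    { carrier := {F | ∃ a ∈ A, ∀ y : Y, F y = a y + F OnePoint.infty}
      mul_mem' := by
        rintro F F' ⟨a, ha, h⟩ ⟨a', ha', h'⟩
        refine ⟨a * a' + (F OnePoint.infty • a' + F' OnePoint.infty • a), A.add_mem
          (A.mul_mem ha ha') (A.add_mem (A.smul_mem _ ha') (A.smul_mem _ ha)), fun y => ?_⟩
        simp only [ContinuousMap.mul_apply, h, h', ZeroAtInftyContinuousMap.add_apply,
          ZeroAtInftyContinuousMap.mul_apply, ZeroAtInftyContinuousMap.smul_apply, smul_eq_mul]
        ring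
      add_mem' := by
        rintro F F' ⟨a, ha, h⟩ ⟨a', ha', h'⟩
        refine ⟨a + a', A.add_mem ha ha', fun y => ?_⟩
        simp only [ContinuousMap.add_apply, h, h', ZeroAtInftyContinuousMap.add_apply]
        ring
      algebraMap_mem' := fun c => ⟨0, A.zero_mem, fun y => by simp⟩
      star_mem' := by
        rintro F ⟨a, ha, h⟩
        refine ⟨star a, star_mem ha, fun y => ?_⟩
        simp only [ContinuousMap.star_apply, h, star_add, ZeroAtInftyContinuousMap.star_apply] }
  let ext : C₀(Y, ℂ) → C(OnePoint Y, ℂ) := fun φ =>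
    OnePoint.continuousMapMk φ.toContinuousMap 0 (by
      rw [Filter.coclosedCompact_eq_cocompact]
      exact φ.zero_at_infty')
  have hext : ∀ φ (y : Y), ext φ y = φ y := fun _ _ => rfl
  have hext' : ∀ φ, ext φ OnePoint.infty = 0 := fun _ => rfl
  have hextS : ∀ a ∈ A, ext a ∈ S := fun a ha => ⟨a, ha, fun y => by rw [hext, hext', add_zero]⟩
  have hS : S.SeparatesPoints := by
    intro x y hxy
    induction x using OnePoint.rec with
    | infty =>
      induction y using OnePoint.rec with
      | infty => exact absurd rfl hxy
      | coe y =>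
        obtain ⟨a, ha, h⟩ := hne y
        exact ⟨ext a, ⟨ext a, hextS a ha, rfl⟩, by rw [hext, hext']; exact h.symm⟩
    | coe x =>
      induction y using OnePoint.rec with
      | infty =>
        obtain ⟨a, ha, h⟩ := hne x
        exact ⟨ext a, ⟨ext a, hextS a ha, rfl⟩, by rw [hext, hext']; exact h⟩
      | coe y =>
        obtain ⟨a, ha, h⟩ := hsep x y fun h => hxy (by rw [h])
        exact ⟨ext a, ⟨ext a, hextS a ha, rfl⟩, by rw [hext, hext]; exact h⟩
  have htop := ContinuousMap.starSubalgebra_topologicalClosure_eq_top_of_separatesPoints S hS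
  intro φ
  rw [Metric.mem_closure_iff]
  intro ε hε
  have hmem : ext φ ∈ closure (S : Set C(OnePoint Y, ℂ)) := by
    rw [← StarSubalgebra.topologicalClosure_coe, htop]
    trivial
  obtain ⟨F, ⟨a, ha, hF⟩, hd⟩ := Metric.mem_closure_iff.1 hmem (ε / 3) (by positivity)
  refine ⟨a, ha, ?_⟩
  rw [dist_eq_norm] at hd ⊢
  have hpt := (ContinuousMap.norm_lt_iff _ (by positivity : (0 : ℝ) < ε / 3)).1 hd
  have hinf : ‖F OnePoint.infty‖ < ε / 3 := by simpa [hext'] using hpt OnePoint.infty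
  refine lt_of_le_of_lt ((c0_norm_le (by positivity : 0 ≤ 2 * (ε / 3))).2 fun y => ?_)
    (by linarith)
  have h1 := hpt y
  rw [ContinuousMap.sub_apply, hext, hF] at h1
  calc ‖(φ - a) y‖ = ‖(φ y - (a y + F OnePoint.infty)) + F OnePoint.infty‖ := by
        rw [ZeroAtInftyContinuousMap.sub_apply]; ring_nf
    _ ≤ ‖φ y - (a y + F OnePoint.infty)‖ + ‖F OnePoint.infty‖ := norm_add_le _ _
    _ ≤ 2 * (ε / 3) := by linarith

end ZeroAtInfty

/-! ### Density of Fourier transforms in C₀(Ĝ) -/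

section Density

variable {G : Type*} [CommGroup G] [TopologicalSpace G] [IsTopologicalGroup G]
  [LocallyCompactSpace G] [T2Space G] [MeasurableSpace G] [BorelSpace G]
  (θ : Measure G) [θ.IsHaarMeasure]

theorem denseRange_fourierC0 : DenseRange (fourierC0 θ) := by
  let A : NonUnitalStarSubalgebra ℂ C₀(PontryaginDual G, ℂ) :=
    { LinearMap.range (fourierC0 θ) with
      mul_mem' := by
        rintro _ _ ⟨g, rfl⟩ ⟨h, rfl⟩
        exact ⟨ccConv θ g h, fourierC0_ccConv θ g h⟩
      star_mem' := by
        rintro _ ⟨g, rfl⟩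
        exact ⟨ccStar g, fourierC0_ccStar θ g⟩ }
  refine dense_of_separates A (fun χ χ' h => ?_) fun χ => ?_
  · obtain ⟨g, hg⟩ := exists_fourierInt_separates θ h
    exact ⟨fourierC0 θ g, ⟨g, rfl⟩, hg⟩
  · obtain ⟨g, hg⟩ := exists_fourierInt_ne_zero θ (isCompact_singleton (x := χ))
    exact ⟨fourierC0 θ g, ⟨g, rfl⟩, hg χ rfl⟩

end Density

/-! ### Averaging functionals on C₀ over translations -/

section Translate

variable {Γ : Type*} [CommGroup Γ] [TopologicalSpace Γ] [IsTopologicalGroup Γ]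

/-- Translation of functions vanishing at infinity. -/
def c0Translate (η : Γ) (φ : C₀(Γ, ℂ)) : C₀(Γ, ℂ) :=
  φ.comp (Homeomorph.mulLeft η⁻¹).toCocompactMap

@[simp] theorem c0Translate_apply (η : Γ) (φ : C₀(Γ, ℂ)) (χ : Γ) :
    c0Translate η φ χ = φ (η⁻¹ * χ) := rfl

theorem continuous_c0Translate (η : Γ) : Continuous (c0Translate η) := by
  refine LipschitzWith.continuous (K := 1) (LipschitzWith.of_dist_le_mul fun φ ψ => ?_)
  rw [NNReal.coe_one, one_mul, dist_eq_norm, dist_eq_norm]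
  exact (c0_norm_le (norm_nonneg _)).2 fun χ => c0_norm_apply_le (φ - ψ) (η⁻¹ * χ)

theorem continuous_ccC0_mul_translate (a b : C_c(Γ, ℂ)) :
    Continuous fun η => ccC0 (a * ccTranslate η b) := by
  rw [continuous_iff_continuousAt]
  intro η₀
  rw [ContinuousAt, ZeroAtInftyContinuousMap.tendsto_iff_tendstoUniformly]
  let F : C(Γ, C(Γ, ℂ)) := ContinuousMap.curry ⟨fun p : Γ × Γ => a p.2 * b (p.1⁻¹ * p.2), by
    have := a.continuous
    have := b.continuous
    fun_prop⟩
  have h := (ContinuousMap.tendsto_iff_forall_isCompact_tendstoUniformlyOn.1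
    (F.continuous.tendsto η₀)) (tsupport a) a.hasCompactSupport
  rw [Metric.tendstoUniformlyOn_iff] at h
  rw [Metric.tendstoUniformly_iff]
  intro ε hε
  filter_upwards [h ε hε] with η hη χ
  by_cases hχ : χ ∈ tsupport a
  · exact hη χ hχ
  · simp [image_eq_zero_of_notMem_tsupport hχ, hε]

theorem hasCompactSupport_ccC0_mul_translate [T2Space Γ] (a b : C_c(Γ, ℂ)) :
    HasCompactSupport fun η => ccC0 (a * ccTranslate η b) := by
  refine HasCompactSupport.intro (K := tsupport a * (tsupport b)⁻¹)
    (a.hasCompactSupport.isCompact.mul b.hasCompactSupport.isCompact.inv) fun η hη => ?_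
  ext χ
  change a χ * b (η⁻¹ * χ) = 0
  by_cases ha : χ ∈ tsupport a
  · have : η⁻¹ * χ ∉ tsupport b := fun hb =>
      hη ⟨χ, ha, (η⁻¹ * χ)⁻¹, Set.inv_mem_inv.2 hb, by simp⟩
    rw [image_eq_zero_of_notMem_tsupport this, mul_zero]
  · rw [image_eq_zero_of_notMem_tsupport ha, zero_mul]

variable [LocallyCompactSpace Γ] [T2Space Γ] [MeasurableSpace Γ] [BorelSpace Γ]
  (ν : Measure Γ) [ν.IsHaarMeasure]

/-- The C₀-valued integral of `a · τ_η b` over η is `(∫ b) • a`, as evaluation at each point shows;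
`L` commutes with the integral. No integral representation of `L` is required. -/
theorem integral_functional_mul_translate (L : C₀(Γ, ℂ) →L[ℂ] ℂ) (a b : C_c(Γ, ℂ)) :
    ∫ η, L (ccC0 (a * ccTranslate η b)) ∂ν = L (ccC0 a) * ∫ χ, b χ ∂ν := by
  have hint : Integrable (fun η => ccC0 (a * ccTranslate η b)) ν :=
    (continuous_ccC0_mul_translate a b).integrable_of_hasCompactSupport
      (hasCompactSupport_ccC0_mul_translate a b)
  have hval : ∫ η, ccC0 (a * ccTranslate η b) ∂ν = (∫ χ, b χ ∂ν) • ccC0 a := by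
    ext χ
    rw [← c0Eval_apply, ← ContinuousLinearMap.integral_comp_comm _ hint]
    change ∫ η, a χ * b (η⁻¹ * χ) ∂ν = (∫ χ, b χ ∂ν) * a χ
    rw [integral_const_mul, ← integral_div_left_of_hasCompactSupport ν b χ, mul_comm]
    simp_rw [mul_comm χ]
  rw [ContinuousLinearMap.integral_comp_comm _ hint, hval, map_smul, smul_eq_mul, mul_comm]

theorem integral_functional_mul_translate_inv (L : C₀(Γ, ℂ) →L[ℂ] ℂ) (a b : C_c(Γ, ℂ)) :
    ∫ η, L (ccC0 (a * ccTranslate η⁻¹ b)) ∂ν = L (ccC0 a) * ∫ χ, b χ ∂ν := by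
  rw [← integral_functional_mul_translate]
  exact integral_inv_of_hasCompactSupport ν
    (⟨⟨fun η => L (ccC0 (a * ccTranslate η b)),
      L.continuous.comp (continuous_ccC0_mul_translate a b)⟩,
      (hasCompactSupport_ccC0_mul_translate a b).comp_left (map_zero L)⟩ : C_c(Γ, ℂ))

end Translate

/-! ### Functional calculus and vector states -/

section Spectral

variable {G : Type*} [CommGroup G] [TopologicalSpace G] [IsTopologicalGroup G]
  [LocallyCompactSpace G] [T2Space G] [MeasurableSpace G] [BorelSpace G]
  (θ : Measure G) [θ.IsHaarMeasure] [θ.InnerRegularCompactLTTop]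

theorem norm_convOp_le_norm_fourierC0 (g : C_c(G, ℂ)) : ‖convOp θ g‖ ≤ ‖fourierC0 θ g‖ :=
  norm_convOp_le_of_forall θ g (norm_nonneg _) fun χ => c0_norm_apply_le (fourierC0 θ g) χ

/-- The functional calculus `C₀(Ĝ) → B(L²(G))` extending `ĝ ↦ (convolution with g)`. -/
def spectralMap : C₀(PontryaginDual G, ℂ) →L[ℂ] (Lp ℂ 2 θ →L[ℂ] Lp ℂ 2 θ) :=
  (convOp θ).extendOfNorm (fourierC0 θ)

theorem spectralMap_fourierC0 (g : C_c(G, ℂ)) : spectralMap θ (fourierC0 θ g) = convOp θ g :=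
  LinearMap.extendOfNorm_eq (denseRange_fourierC0 θ)
    ⟨1, fun g => by rw [one_mul]; exact norm_convOp_le_norm_fourierC0 θ g⟩ g

theorem norm_spectralMap_le (φ : C₀(PontryaginDual G, ℂ)) : ‖spectralMap θ φ‖ ≤ ‖φ‖ := by
  have := LinearMap.norm_extendOfNorm_apply_le (f := convOp θ) (denseRange_fourierC0 θ) 1
    (fun g => by rw [one_mul]; exact norm_convOp_le_norm_fourierC0 θ g) φ
  rwa [one_mul] at this

/-- The functional `φ ↦ ⟨f, φ f⟩` defined by a vector `f`. -/
def vectorState (f : C_c(G, ℂ)) : C₀(PontryaginDual G, ℂ) →L[ℂ] ℂ :=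
  (innerSL ℂ (ccLp θ f)).comp
    ((ContinuousLinearMap.apply ℂ (Lp ℂ 2 θ) (ccLp θ f)).comp (spectralMap θ))

theorem vectorState_apply (f : C_c(G, ℂ)) (φ : C₀(PontryaginDual G, ℂ)) :
    vectorState θ f φ = ⟪ccLp θ f, spectralMap θ φ (ccLp θ f)⟫_ℂ := rfl

theorem vectorState_fourierC0 (f k : C_c(G, ℂ)) :
    vectorState θ f (fourierC0 θ k) = ⟪ccLp θ f, ccLp θ (ccConv θ k f)⟫_ℂ := by
  rw [vectorState_apply, spectralMap_fourierC0, convOp_ccLp]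

theorem norm_vectorState_le (f : C_c(G, ℂ)) (φ : C₀(PontryaginDual G, ℂ)) :
    ‖vectorState θ f φ‖ ≤ ‖φ‖ * ‖ccLp θ f‖ ^ 2 := by
  rw [vectorState_apply]
  calc _ ≤ ‖ccLp θ f‖ * ‖spectralMap θ φ (ccLp θ f)‖ := norm_inner_le_norm _ _
    _ ≤ ‖ccLp θ f‖ * (‖φ‖ * ‖ccLp θ f‖) := by
      gcongr
      exact (ContinuousLinearMap.le_opNorm _ _).trans (by gcongr; exact norm_spectralMap_le θ φ)
    _ = _ := by ring

/-- The squared absolute value of a Fourier transform. -/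
def sqFourier (g : C_c(G, ℂ)) : C₀(PontryaginDual G, ℂ) := star (fourierC0 θ g) * fourierC0 θ g

omit [θ.InnerRegularCompactLTTop] [T2Space G] in
theorem sqFourier_apply (g : C_c(G, ℂ)) (χ : PontryaginDual G) :
    sqFourier θ g χ = ((‖fourierInt θ g χ‖ ^ 2 : ℝ) : ℂ) := by
  change (starRingEnd ℂ) (fourierInt θ g χ) * fourierInt θ g χ = _
  rw [mul_comm, Complex.mul_conj, Complex.normSq_eq_norm_sq]

omit [θ.InnerRegularCompactLTTop] [T2Space G] in
theorem sqFourier_twist (η : PontryaginDual G) (g : C_c(G, ℂ)) :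
    sqFourier θ (ccTwist η g) = c0Translate η (sqFourier θ g) := by
  ext χ
  rw [c0Translate_apply, sqFourier_apply, sqFourier_apply, fourierInt_twist]

/-- By density take φ = k̂. Then φ|ĝ|² is the transform of g* ∗ k ∗ g, and the factor g* moves
across the inner product. -/
theorem vectorState_mul_sqFourier_eq (f g : C_c(G, ℂ)) (φ : C₀(PontryaginDual G, ℂ)) :
    vectorState θ f (φ * sqFourier θ g) = vectorState θ (ccConv θ g f) φ := by
  refine congrFun (Continuous.ext_on (denseRange_fourierC0 θ)
    (f := fun φ => vectorState θ f (φ * sqFourier θ g)) (g := vectorState θ (ccConv θ g f))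
    ((vectorState θ f).continuous.comp (continuous_mul_const _))
    (vectorState θ _).continuous ?_) φ
  rintro _ ⟨k, rfl⟩
  simp only
  have h1 : fourierC0 θ k * sqFourier θ g =
      fourierC0 θ (ccConv θ (ccStar g) (ccConv θ k g)) := by
    rw [fourierC0_ccConv, fourierC0_ccConv, fourierC0_ccStar, sqFourier,
      mul_left_comm]
  rw [h1, vectorState_apply, spectralMap_fourierC0, vectorState_apply, spectralMap_fourierC0,
    convOp_ccConv, convOp_ccConv, mul_apply_eq_comp, mul_apply_eq_comp, ← convOp_ccLp,
    ← inner_conj_symm, inner_convOp_ccStar, inner_conj_symm]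

theorem vectorState_mul_sqFourier_comm (f g : C_c(G, ℂ)) (φ : C₀(PontryaginDual G, ℂ)) :
    vectorState θ f (φ * sqFourier θ g) = vectorState θ g (φ * sqFourier θ f) := by
  rw [vectorState_mul_sqFourier_eq, vectorState_mul_sqFourier_eq, ccConv_comm]

theorem inner_ccLp_twist (η : PontryaginDual G) (f g : C_c(G, ℂ)) :
    ⟪ccLp θ (ccTwist η f), ccLp θ (ccTwist η g)⟫_ℂ = ⟪ccLp θ f, ccLp θ g⟫_ℂ := by
  rw [inner_ccLp_ccLp, inner_ccLp_ccLp]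
  refine integral_congr_ae (.of_forall fun x => ?_)
  have h1 : (starRingEnd ℂ) (η x : ℂ) * (η x : ℂ) = 1 := by
    rw [← Circle.coe_inv_eq_conj, Circle.coe_inv, inv_mul_cancel₀ (Circle.coe_ne_zero _)]
  simp only [ccTwist_apply, map_mul]
  linear_combination (starRingEnd ℂ) (f x) * g x * h1

theorem vectorState_twist (η : PontryaginDual G) (f : C_c(G, ℂ)) (φ : C₀(PontryaginDual G, ℂ)) :
    vectorState θ (ccTwist η f) (c0Translate η φ) = vectorState θ f φ := by
  refine congrFun (Continuous.ext_on (denseRange_fourierC0 θ)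
    (f := fun φ => vectorState θ (ccTwist η f) (c0Translate η φ)) (g := vectorState θ f)
    ((vectorState θ _).continuous.comp (continuous_c0Translate η))
    (vectorState θ _).continuous ?_) φ
  rintro _ ⟨k, rfl⟩
  simp only
  have h1 : c0Translate η (fourierC0 θ k) = fourierC0 θ (ccTwist η k) := by
    ext χ
    exact (fourierInt_twist θ η k χ).symm
  rw [h1, vectorState_fourierC0, vectorState_fourierC0, ccConv_twist, inner_ccLp_twist]

variable [MeasurableSpace (PontryaginDual G)] [BorelSpace (PontryaginDual G)]
  (θ' : Measure (PontryaginDual G)) [θ'.IsHaarMeasure]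

/-- The functional of `f` at φ·τ_η(ψ|ĝ|²) equals that of `g` at ψ·τ_{η⁻¹}(φ|f̂|²), by the symmetry
in `f`, `g` and invariance under twisting by η. Integrating over η turns the translated factors into
integrals. -/
theorem vectorState_mul_integral (f g : C_c(G, ℂ)) (φ ψ : C_c(PontryaginDual G, ℂ)) :
    vectorState θ f (ccC0 φ) * ∫ χ, ψ χ * sqFourier θ g χ ∂θ' =
      vectorState θ g (ccC0 ψ) * ∫ χ, φ χ * sqFourier θ f χ ∂θ' := by
  have h1 := integral_functional_mul_translate θ' (vectorState θ f) φ (ccMulC0 ψ (sqFourier θ g))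
  have h2 := integral_functional_mul_translate_inv θ' (vectorState θ g) ψ
    (ccMulC0 φ (sqFourier θ f))
  simp only [ccMulC0_apply] at h1 h2
  rw [← h1, ← h2]
  refine integral_congr_ae (.of_forall fun η => ?_)
  simp only
  have e1 : ccC0 (φ * ccTranslate η (ccMulC0 ψ (sqFourier θ g))) =
      ccC0 (φ * ccTranslate η ψ) * sqFourier θ (ccTwist η g) := by
    rw [sqFourier_twist]
    ext χ
    change φ χ * (ψ (η⁻¹ * χ) * sqFourier θ g (η⁻¹ * χ)) =
      φ χ * ψ (η⁻¹ * χ) * sqFourier θ g (η⁻¹ * χ)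
    ring
  have e2 : ccC0 (φ * ccTranslate η ψ) * sqFourier θ f =
      c0Translate η (ccC0 (ψ * ccTranslate η⁻¹ (ccMulC0 φ (sqFourier θ f)))) := by
    ext χ
    change φ χ * ψ (η⁻¹ * χ) * sqFourier θ f χ = ψ (η⁻¹ * χ) *
      (φ (η⁻¹⁻¹ * (η⁻¹ * χ)) * sqFourier θ f (η⁻¹⁻¹ * (η⁻¹ * χ)))
    rw [inv_inv, mul_inv_cancel_left]
    ring
  rw [e1, vectorState_mul_sqFourier_comm, e2, vectorState_twist]

end Spectral

/-! ### Plancherel's theorem on C_c(G), up to a constant -/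

section Plancherel

variable {G : Type*} [CommGroup G] [TopologicalSpace G] [IsTopologicalGroup G]
  [LocallyCompactSpace G] [T2Space G] [MeasurableSpace G] [BorelSpace G]
  (θ : Measure G) [θ.IsHaarMeasure] [θ.InnerRegularCompactLTTop]

/-- Approximate identities for convolution on `L²(G)`. -/
theorem exists_norm_convOp_sub_le (v : Lp ℂ 2 θ) {ε : ℝ} (hε : 0 < ε) :
    ∃ k : C_c(G, ℂ), ‖fourierC0 θ k‖ ≤ 1 ∧ ‖convOp θ k v - v‖ ≤ ε := by
  have hcv := continuous_translation_apply θ v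
  have hU : IsOpen {x | ‖translation θ x v - v‖ < ε} :=
    isOpen_lt (by fun_prop) continuous_const
  obtain ⟨η, h1, hsupp, hη⟩ := exists_cutoff (isCompact_singleton (x := (1 : G))) hU (by
    simp [translation_one, hε])
  have hc : 0 < ∫ x, η x ∂θ := by
    refine η.continuous.integral_pos_of_hasCompactSupport_nonneg_nonzero η.hasCompactSupport
      (fun x => (hη x).1) (x := 1) ?_
    rw [h1 rfl]
    simp
  set c := ∫ x, η x ∂θ with hcdef
  have hηc := η.continuous
  let k : C_c(G, ℂ) := ⟨⟨fun x => ((η x / c : ℝ) : ℂ), by fun_prop⟩,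
    η.hasCompactSupport.comp_left (g := fun r : ℝ => ((r / c : ℝ) : ℂ)) (by simp)⟩
  have hk : ∀ x, k x = ((η x / c : ℝ) : ℂ) := fun _ => rfl
  have hnk : ∀ x, ‖k x‖ = η x / c := fun x => by
    rw [hk, Complex.norm_real, Real.norm_of_nonneg (div_nonneg (hη x).1 hc.le)]
  have hi1 : ∫ x, ‖k x‖ ∂θ = 1 := by
    simp_rw [hnk]
    rw [integral_div, div_self hc.ne']
  have hi2 : ∫ x, k x ∂θ = 1 := by
    simp_rw [hk]
    rw [integral_complex_ofReal, integral_div, div_self hc.ne', Complex.ofReal_one]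
  refine ⟨k, (c0_norm_le zero_le_one).2 fun χ => (norm_fourierInt_le θ k χ).trans_eq hi1, ?_⟩
  have h2 : convOp θ k v - v = ∫ x, k x • (translation θ x v - v) ∂θ := by
    simp_rw [smul_sub]
    rw [integral_sub (integrable_cc_smul θ k hcv) (integrable_cc_smul θ k continuous_const),
      integral_smul_const, hi2, one_smul, convOp_apply]
  rw [h2]
  refine (norm_integral_le_of_norm_le (g := fun x => ‖k x‖ * ε) (k.integrable.norm.mul_const _)
    (.of_forall fun x => ?_)).trans_eq ?_
  · rw [norm_smul]
    by_cases hx : x ∈ tsupport η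
    · gcongr
      exact (hsupp hx).le
    · rw [hnk, image_eq_zero_of_notMem_tsupport hx]
      simp
  · rw [integral_mul_const, hi1, one_mul]

/-- An approximate identity shows that the functional of `g` has norm at least ‖g‖², so no mass is
lost. -/
theorem exists_le_norm_vectorState (g : C_c(G, ℂ)) {ε : ℝ} (hε : 0 < ε) :
    ∃ φ : C₀(PontryaginDual G, ℂ), ‖φ‖ ≤ 1 ∧ ‖ccLp θ g‖ ^ 2 - ε * ‖ccLp θ g‖ ≤
      ‖vectorState θ g φ‖ := by
  obtain ⟨k, hk, hkε⟩ := exists_norm_convOp_sub_le θ (ccLp θ g) hε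
  refine ⟨fourierC0 θ k, hk, ?_⟩
  rw [vectorState_apply, spectralMap_fourierC0]
  set v := ccLp θ g
  have h1 : (‖v‖ : ℂ) ^ 2 = ⟪v, convOp θ k v⟫_ℂ - ⟪v, convOp θ k v - v⟫_ℂ := by
    rw [inner_sub_right, sub_sub_cancel, inner_self_eq_norm_sq_to_K]
    rfl
  have h2 : ‖v‖ ^ 2 = ‖⟪v, convOp θ k v⟫_ℂ - ⟪v, convOp θ k v - v⟫_ℂ‖ := by
    rw [← h1]
    simp
  have h3 : ‖⟪v, convOp θ k v - v⟫_ℂ‖ ≤ ‖v‖ * ε :=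
    (norm_inner_le_norm _ _).trans (by gcongr)
  have h4 := norm_sub_le ⟪v, convOp θ k v⟫_ℂ ⟪v, convOp θ k v - v⟫_ℂ
  linarith

variable [MeasurableSpace (PontryaginDual G)] [BorelSpace (PontryaginDual G)]
  (θ' : Measure (PontryaginDual G)) [θ'.IsHaarMeasure]

/-- Fix `f` and φ with the functional of `f` nonzero at φ; `vectorState_mul_integral` then makes the
ratio independent of `g` and ψ. -/
theorem exists_integral_mul_sqFourier_eq :
    ∃ c : ℂ, ∀ (g : C_c(G, ℂ)) (ψ : C_c(PontryaginDual G, ℂ)),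
      ∫ χ, ψ χ * sqFourier θ g χ ∂θ' = c * vectorState θ g (ccC0 ψ) := by
  obtain ⟨f, hf⟩ : ∃ f : C_c(G, ℂ), ccLp θ f ≠ 0 := by
    by_contra! h0
    obtain ⟨g, hg⟩ := exists_fourierInt_ne_zero θ (isCompact_singleton (x := (1 : PontryaginDual G)))
    refine hg 1 rfl ?_
    have : (g : G → ℂ) =ᵐ[θ] 0 := by
      refine (coeFn_ccLp g).symm.trans ?_
      rw [h0]
      exact Lp.coeFn_zero _ _ _
    rw [fourierInt, integral_eq_zero_of_ae]
    filter_upwards [this] with x hx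
    simp [hx]
  have hf' : 0 < ‖ccLp θ f‖ := norm_pos_iff.2 hf
  obtain ⟨φ₁, -, h1⟩ := exists_le_norm_vectorState θ f (half_pos hf')
  obtain ⟨φ, hφ⟩ : ∃ φ : C_c(PontryaginDual G, ℂ), vectorState θ f (ccC0 φ) ≠ 0 := by
    by_contra! h0
    have := congrFun (Continuous.ext_on (denseRange_ccC0 (Y := PontryaginDual G))
      (f := vectorState θ f) (g := fun _ => 0) (vectorState θ f).continuous continuous_const
      (by rintro _ ⟨k, rfl⟩; exact h0 k)) φ₁
    rw [this, norm_zero] at h1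
    nlinarith
  refine ⟨(∫ χ, φ χ * sqFourier θ f χ ∂θ') / vectorState θ f (ccC0 φ), fun g ψ => ?_⟩
  have := vectorState_mul_integral θ θ' f g φ ψ
  field_simp
  linear_combination this

variable {θ θ'} {c : ℂ}
  (hc : ∀ (g : C_c(G, ℂ)) (ψ : C_c(PontryaginDual G, ℂ)),
    ∫ χ, ψ χ * sqFourier θ g χ ∂θ' = c * vectorState θ g (ccC0 ψ))

include hc

theorem setIntegral_norm_sq_fourierInt_le (g : C_c(G, ℂ)) {K : Set (PontryaginDual G)}
    (hK : IsCompact K) :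
    ∫ χ in K, ‖fourierInt θ g χ‖ ^ 2 ∂θ' ≤ ‖c‖ * ‖ccLp θ g‖ ^ 2 := by
  obtain ⟨ψ, h1, hψ⟩ := exists_cc_cutoff hK
  have hcont := continuous_fourierInt θ g
  have hψc := ψ.continuous
  have hre : ∀ χ, ψ χ = ((ψ χ).re : ℂ) ∧ 0 ≤ (ψ χ).re ∧ ‖ψ χ‖ ≤ 1 := fun χ => by
    obtain ⟨r, hr, h⟩ := hψ χ
    rw [h]
    simp [abs_of_nonneg hr.1, hr.1, hr.2]
  have hint : Integrable (fun χ => (ψ χ).re * ‖fourierInt θ g χ‖ ^ 2) θ' := by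
    refine Continuous.integrable_of_hasCompactSupport (by fun_prop) ?_
    exact HasCompactSupport.mul_right
      (ψ.hasCompactSupport.comp_left (g := Complex.re) Complex.zero_re)
  have h2 : ∫ χ, ψ χ * sqFourier θ g χ ∂θ' =
      ((∫ χ, (ψ χ).re * ‖fourierInt θ g χ‖ ^ 2 ∂θ' : ℝ) : ℂ) := by
    rw [← integral_complex_ofReal]
    refine integral_congr_ae (.of_forall fun χ => ?_)
    simp only
    rw [sqFourier_apply, Complex.ofReal_mul, ← (hre χ).1]
  calc ∫ χ in K, ‖fourierInt θ g χ‖ ^ 2 ∂θ'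
      = ∫ χ in K, (ψ χ).re * ‖fourierInt θ g χ‖ ^ 2 ∂θ' := by
        refine setIntegral_congr_fun hK.measurableSet fun χ hχ => ?_
        simp [h1 χ hχ]
    _ ≤ ∫ χ, (ψ χ).re * ‖fourierInt θ g χ‖ ^ 2 ∂θ' :=
        setIntegral_le_integral hint (.of_forall fun χ => mul_nonneg (hre χ).2.1 (by positivity))
    _ ≤ ‖∫ χ, ψ χ * sqFourier θ g χ ∂θ'‖ := by
        rw [h2, Complex.norm_real]
        exact Real.le_norm_self _
    _ ≤ ‖c‖ * (1 * ‖ccLp θ g‖ ^ 2) := by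
        rw [hc, norm_mul]
        gcongr
        refine (norm_vectorState_le θ g _).trans ?_
        gcongr
        exact (c0_norm_le zero_le_one).2 fun χ => (hre χ).2.2
    _ = _ := by rw [one_mul]

/-- By Riemann–Lebesgue the set where ĝ ≠ 0 is a countable increasing union of compact sets, so
monotone convergence applies although Ĝ need not be σ-compact. -/
theorem lintegral_enorm_sq_fourierInt_le (g : C_c(G, ℂ)) :
    ∫⁻ χ, ‖fourierInt θ g χ‖ₑ ^ 2 ∂θ' ≤ ENNReal.ofReal (‖c‖ * ‖ccLp θ g‖ ^ 2) := by
  have hcont := continuous_fourierInt θ g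
  let K : ℕ → Set (PontryaginDual G) := fun n => {χ | 1 / ((n : ℝ) + 1) ≤ ‖fourierInt θ g χ‖}
  have hK : ∀ n, IsCompact (K n) := fun n => isCompact_setOf_le_fourierInt θ g (by positivity)
  have hmono : Monotone K := fun m n hmn χ hχ =>
    show _ ≤ ‖fourierInt θ g χ‖ from (Nat.one_div_le_one_div hmn).trans hχ
  have h1 : ∫⁻ χ, ‖fourierInt θ g χ‖ₑ ^ 2 ∂θ' =
      ∫⁻ χ in ⋃ n, K n, ‖fourierInt θ g χ‖ₑ ^ 2 ∂θ' := by
    rw [← lintegral_indicator (MeasurableSet.iUnion fun n => (hK n).measurableSet)]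
    refine lintegral_congr fun χ => ?_
    by_cases hχ : χ ∈ ⋃ n, K n
    · rw [Set.indicator_of_mem hχ]
    · rw [Set.indicator_of_notMem hχ]
      have : fourierInt θ g χ = 0 := by
        by_contra hne
        obtain ⟨n, hn⟩ := exists_nat_one_div_lt (norm_pos_iff.2 hne)
        exact hχ (Set.mem_iUnion.2 ⟨n, hn.le⟩)
      simp [this]
  rw [h1, setLIntegral_iUnion_of_directed _ hmono.directed_le]
  refine iSup_le fun n => ?_
  have hint : IntegrableOn (fun χ => ‖fourierInt θ g χ‖ ^ 2) (K n) θ' :=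
    Continuous.continuousOn (by fun_prop) |>.integrableOn_compact (hK n)
  have h2 := ofReal_integral_eq_lintegral_ofReal hint (.of_forall fun χ => by positivity)
  have h3 : ∫⁻ χ in K n, ‖fourierInt θ g χ‖ₑ ^ 2 ∂θ' =
      ∫⁻ χ in K n, ENNReal.ofReal (‖fourierInt θ g χ‖ ^ 2) ∂θ' := by
    refine lintegral_congr fun χ => ?_
    rw [ENNReal.ofReal_pow (norm_nonneg _), ofReal_norm]
  rw [h3, ← h2]
  exact ENNReal.ofReal_le_ofReal (setIntegral_norm_sq_fourierInt_le hc g (hK n))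

theorem memLp_fourierInt_of_eq (g : C_c(G, ℂ)) : MemLp (fourierInt θ g) 2 θ' := by
  refine ⟨(continuous_fourierInt θ g).aestronglyMeasurable, ?_⟩
  rw [eLpNorm_lt_top_iff_lintegral_rpow_enorm_lt_top (by simp) (by simp)]
  have := lintegral_enorm_sq_fourierInt_le hc g
  simp only [ENNReal.toReal_ofNat, ENNReal.rpow_ofNat]
  exact this.trans_lt ENNReal.ofReal_lt_top

/-- For the lower bound, integrability of |ĝ|² extends `hc` from C_c to C₀; it is then tested on φ
of norm at most 1 at which the functional nearly reaches ‖g‖². -/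
theorem integral_norm_sq_fourierInt_eq (g : C_c(G, ℂ)) :
    ∫ χ, ‖fourierInt θ g χ‖ ^ 2 ∂θ' = ‖c‖ * ‖ccLp θ g‖ ^ 2 := by
  have hint : Integrable (fun χ => ‖fourierInt θ g χ‖ ^ 2) θ' :=
    (memLp_fourierInt_of_eq hc g).integrable_norm_pow (p := 2) (by simp)
  have hsq : Integrable (fun χ => sqFourier θ g χ) θ' := by
    simp_rw [sqFourier_apply]
    exact hint.ofReal
  refine le_antisymm ?_ ?_
  · refine (ENNReal.ofReal_le_ofReal_iff (by positivity)).1 ?_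
    rw [ofReal_integral_eq_lintegral_ofReal hint (.of_forall fun χ => by positivity)]
    refine le_trans (le_of_eq (lintegral_congr fun χ => ?_)) (lintegral_enorm_sq_fourierInt_le hc g)
    rw [ENNReal.ofReal_pow (norm_nonneg _), ofReal_norm]
  · have hbd : ∀ φ : C₀(PontryaginDual G, ℂ), ‖∫ χ, φ χ * sqFourier θ g χ ∂θ'‖ ≤
        ‖φ‖ * ∫ χ, ‖fourierInt θ g χ‖ ^ 2 ∂θ' := fun φ => by
      rw [← integral_const_mul]
      refine norm_integral_le_of_norm_le (hint.const_mul _) (.of_forall fun χ => ?_)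
      rw [norm_mul, sqFourier_apply, Complex.norm_real, Real.norm_of_nonneg (by positivity)]
      gcongr
      exact c0_norm_apply_le φ χ
    have hmi : ∀ φ : C₀(PontryaginDual G, ℂ), Integrable (fun χ => φ χ * sqFourier θ g χ) θ' :=
      fun φ => hsq.bdd_mul (c := ‖φ‖) (map_continuous φ).aestronglyMeasurable
        (.of_forall fun χ => c0_norm_apply_le φ χ)
    have hcont : Continuous fun φ : C₀(PontryaginDual G, ℂ) =>
        ∫ χ, φ χ * sqFourier θ g χ ∂θ' := by
      let L : C₀(PontryaginDual G, ℂ) →ₗ[ℂ] ℂ :=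
        { toFun := fun φ => ∫ χ, φ χ * sqFourier θ g χ ∂θ'
          map_add' := fun φ ψ => by
            rw [← integral_add (hmi φ) (hmi ψ)]
            exact integral_congr_ae (.of_forall fun χ => add_mul _ _ _)
          map_smul' := fun a φ => by
            rw [RingHom.id_apply, smul_eq_mul, ← integral_const_mul]
            exact integral_congr_ae (.of_forall fun χ => mul_assoc _ _ _) }
      exact (L.mkContinuous _ fun φ => (hbd φ).trans_eq (mul_comm _ _)).continuous
    have hall : ∀ φ : C₀(PontryaginDual G, ℂ), ∫ χ, φ χ * sqFourier θ g χ ∂θ' =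
        c * vectorState θ g φ := fun φ =>
      congrFun (Continuous.ext_on (denseRange_ccC0 (Y := PontryaginDual G)) hcont
        (g := fun φ => c * vectorState θ g φ) ((vectorState θ g).continuous.const_mul c)
        (by rintro _ ⟨k, rfl⟩; exact hc g k)) φ
    have hε : ∀ ε : ℝ, 0 < ε → ‖c‖ * (‖ccLp θ g‖ ^ 2 - ε * ‖ccLp θ g‖) ≤
        ∫ χ, ‖fourierInt θ g χ‖ ^ 2 ∂θ' := fun ε hε => by
      obtain ⟨φ, hφ, h⟩ := exists_le_norm_vectorState θ g hε
      calc _ ≤ ‖c‖ * ‖vectorState θ g φ‖ := by gcongr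
        _ = ‖∫ χ, φ χ * sqFourier θ g χ ∂θ'‖ := by rw [hall, norm_mul]
        _ ≤ _ := hbd φ
        _ ≤ 1 * _ := by gcongr
        _ = _ := one_mul _
    have hlim : Filter.Tendsto (fun ε : ℝ => ‖c‖ * (‖ccLp θ g‖ ^ 2 - ε * ‖ccLp θ g‖)) (𝓝[>] 0)
        (𝓝 (‖c‖ * (‖ccLp θ g‖ ^ 2 - 0 * ‖ccLp θ g‖))) :=
      (Continuous.tendsto (by fun_prop) 0).mono_left nhdsWithin_le_nhds
    rw [zero_mul, sub_zero] at hlim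
    exact le_of_tendsto hlim (by filter_upwards [self_mem_nhdsWithin] with ε h using hε ε h)

omit hc

variable (θ θ')

theorem memLp_fourierInt (g : C_c(G, ℂ)) : MemLp (fourierInt θ g) 2 θ' := by
  obtain ⟨c, hc⟩ := exists_integral_mul_sqFourier_eq θ θ'
  exact memLp_fourierInt_of_eq hc g

/-- Plancherel's theorem for compactly supported continuous functions, with unnormalised
Haar measures. -/
theorem exists_norm_toLp_fourierInt_eq :
    ∃ C : ℝ, 0 < C ∧ ∀ g : C_c(G, ℂ),
      ‖(memLp_fourierInt θ θ' g).toLp (fourierInt θ g)‖ = C * ‖ccLp θ g‖ := by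
  obtain ⟨c, hc⟩ := exists_integral_mul_sqFourier_eq θ θ'
  have key : ∀ g : C_c(G, ℂ),
      ‖(memLp_fourierInt θ θ' g).toLp (fourierInt θ g)‖ = √‖c‖ * ‖ccLp θ g‖ := fun g => by
    refine (sq_eq_sq₀ (norm_nonneg _) (by positivity)).1 ?_
    rw [mul_pow, Real.sq_sqrt (norm_nonneg c), ← integral_norm_sq_fourierInt_eq hc g,
      ← inner_self_eq_norm_sq (𝕜 := ℂ), L2.inner_def, ← integral_re (L2.integrable_inner _ _)]
    refine integral_congr_ae ?_
    filter_upwards [(memLp_fourierInt θ θ' g).coeFn_toLp] with χ hχ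
    rw [hχ, inner_self_eq_norm_sq]
  -- If the constant were 0, every ĝ would vanish a.e., hence everywhere by continuity.
  refine ⟨√‖c‖, (Real.sqrt_nonneg _).lt_of_ne' fun h0 => ?_, key⟩
  obtain ⟨g, hg⟩ := exists_fourierInt_ne_zero θ (isCompact_singleton (x := (1 : PontryaginDual G)))
  have h1 := key g
  rw [h0, zero_mul, norm_eq_zero] at h1
  have h2 : fourierInt θ g =ᵐ[θ'] 0 := by
    refine (memLp_fourierInt θ θ' g).coeFn_toLp.symm.trans ?_
    rw [h1]
    exact Lp.coeFn_zero _ _ _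
  have h3 := ((continuous_fourierInt θ g).ae_eq_iff_eq θ' continuous_zero).1 h2
  exact hg 1 rfl (congrFun h3 1)

end Plancherel

/-! ### The Plancherel transform, its surjectivity, and `fourierL2` -/

section Extension

variable {G : Type*} [CommGroup G] [TopologicalSpace G] [IsTopologicalGroup G]
  [LocallyCompactSpace G] [T2Space G] [MeasurableSpace G] [BorelSpace G]
  (θ : Measure G) [θ.IsHaarMeasure] [θ.InnerRegularCompactLTTop]
  [MeasurableSpace (PontryaginDual G)] [BorelSpace (PontryaginDual G)]
  (θ' : Measure (PontryaginDual G)) [θ'.IsHaarMeasure]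

/-- The Fourier transform of a compactly supported continuous function, as an element of `L²`. -/
def fourierCc : C_c(G, ℂ) →ₗ[ℂ] Lp ℂ 2 θ' where
  toFun g := (memLp_fourierInt θ θ' g).toLp (fourierInt θ g)
  map_add' g h := by
    rw [← MemLp.toLp_add, MemLp.toLp_eq_toLp_iff]
    exact .of_forall fun χ => fourierInt_add θ g h χ
  map_smul' c g := by
    rw [RingHom.id_apply, ← MemLp.toLp_const_smul, MemLp.toLp_eq_toLp_iff]
    exact .of_forall fun χ => fourierInt_smul θ c g χ

theorem coeFn_fourierCc (g : C_c(G, ℂ)) : fourierCc θ θ' g =ᵐ[θ'] fourierInt θ g :=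
  (memLp_fourierInt θ θ' g).coeFn_toLp

/-- The Plancherel transform. -/
def plancherel : Lp ℂ 2 θ →L[ℂ] Lp ℂ 2 θ' := (fourierCc θ θ').extendOfNorm (ccLp θ)

theorem plancherel_ccLp (g : C_c(G, ℂ)) : plancherel θ θ' (ccLp θ g) = fourierCc θ θ' g := by
  obtain ⟨C, -, hC⟩ := exists_norm_toLp_fourierInt_eq θ θ'
  exact LinearMap.extendOfNorm_eq denseRange_ccLp ⟨C, fun g => (hC g).le⟩ g

theorem exists_norm_plancherel_eq :
    ∃ C : ℝ, 0 < C ∧ ∀ v, ‖plancherel θ θ' v‖ = C * ‖v‖ := by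
  obtain ⟨C, hC0, hC⟩ := exists_norm_toLp_fourierInt_eq θ θ'
  refine ⟨C, hC0, fun v => congrFun (Continuous.ext_on (denseRange_ccLp (μ := θ))
    (f := fun v => ‖plancherel θ θ' v‖) (g := fun v => C * ‖v‖) (by fun_prop) (by fun_prop) ?_) v⟩
  rintro _ ⟨g, rfl⟩
  simp only [plancherel_ccLp]
  exact hC g

/-- Choose ĝ without zeros on the support of ψ and write ψ = ρĝ with ρ in C_c. If k̂ is uniformly
close to ρ, then the transform k̂ĝ of k ∗ g is close to ψ in L². -/
theorem denseRange_fourierCc [θ'.InnerRegularCompactLTTop] : DenseRange (fourierCc θ θ') := by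
  have hsub : Set.range (ccLp θ') ⊆ closure (Set.range (fourierCc θ θ')) := by
    rintro _ ⟨ψ, rfl⟩
    obtain ⟨g, hg⟩ := exists_fourierInt_ne_zero θ ψ.hasCompactSupport.isCompact
    have hgc := continuous_fourierInt θ g
    have hquot : Continuous fun χ => ψ χ / fourierInt θ g χ := by
      refine continuous_iff_continuousAt.2 fun χ => ?_
      by_cases hχ : χ ∈ tsupport ψ
      · exact ψ.continuous.continuousAt.div hgc.continuousAt (hg χ hχ)
      · have h0 : (fun χ => ψ χ / fourierInt θ g χ) =ᶠ[𝓝 χ] fun _ => 0 := by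
          filter_upwards [(isClosed_tsupport ψ).isOpen_compl.mem_nhds hχ] with η hη
          rw [image_eq_zero_of_notMem_tsupport hη, zero_div]
        exact (continuousAt_const (y := (0 : ℂ))).congr h0.symm
    let ρ : C_c(PontryaginDual G, ℂ) := ⟨⟨fun χ => ψ χ / fourierInt θ g χ, hquot⟩, by
      simp_rw [div_eq_mul_inv]
      exact ψ.hasCompactSupport.mul_right⟩
    have hρ : ∀ χ, ψ χ = ρ χ * fourierInt θ g χ := fun χ => by
      change _ = ψ χ / fourierInt θ g χ * fourierInt θ g χ
      by_cases hχ : χ ∈ tsupport ψ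
      · rw [div_mul_cancel₀ _ (hg χ hχ)]
      · rw [image_eq_zero_of_notMem_tsupport hχ, zero_div, zero_mul]
    refine Metric.mem_closure_range_iff.2 fun ε hε => ?_
    have hδ : 0 < ε / (‖fourierCc θ θ' g‖ + 1) := by positivity
    obtain ⟨k, hk⟩ := (Metric.denseRange_iff.1 (denseRange_fourierC0 θ)) (ccC0 ρ) _ hδ
    refine ⟨ccConv θ k g, ?_⟩
    rw [dist_eq_norm] at hk ⊢
    have hle : ‖ccLp θ' ψ - fourierCc θ θ' (ccConv θ k g)‖ ≤
        ‖ccC0 ρ - fourierC0 θ k‖ * ‖fourierCc θ θ' g‖ := by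
      refine Lp.norm_le_mul_norm_of_ae_le_mul ?_
      filter_upwards [Lp.coeFn_sub (ccLp θ' ψ) (fourierCc θ θ' (ccConv θ k g)),
        coeFn_ccLp ψ (μ := θ'), coeFn_fourierCc θ θ' (ccConv θ k g), coeFn_fourierCc θ θ' g]
        with χ h1 h2 h3 h4
      rw [h1, Pi.sub_apply, h2, h3, h4, fourierInt_ccConv, hρ, ← sub_mul, norm_mul]
      gcongr
      exact c0_norm_apply_le (ccC0 ρ - fourierC0 θ k) χ
    refine hle.trans_lt ?_
    calc _ ≤ ‖ccC0 ρ - fourierC0 θ k‖ * (‖fourierCc θ θ' g‖ + 1) := by gcongr; linarith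
      _ < ε / (‖fourierCc θ θ' g‖ + 1) * (‖fourierCc θ θ' g‖ + 1) := by gcongr
      _ = ε := div_mul_cancel₀ _ (by positivity)
  exact (denseRange_ccLp (μ := θ')).mono hsub |>.of_closure

theorem surjective_plancherel [θ'.InnerRegularCompactLTTop] :
    Function.Surjective (plancherel θ θ') := by
  obtain ⟨C, hC0, hC⟩ := exists_norm_plancherel_eq θ θ'
  have hcl : IsClosed (Set.range (plancherel θ θ')) := by
    refine (AntilipschitzWith.isClosed_range (K := C⁻¹.toNNReal)
      (ContinuousLinearMap.antilipschitz_of_bound _ fun v => ?_)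
      (plancherel θ θ').uniformContinuous)
    rw [hC, Real.coe_toNNReal _ (by positivity), inv_mul_cancel_left₀ hC0.ne']
  refine Set.range_eq_univ.1 (hcl.closure_eq.symm.trans (Dense.closure_eq ?_))
  refine (denseRange_fourierCc θ θ').mono ?_
  rintro _ ⟨g, rfl⟩
  exact ⟨ccLp θ g, plancherel_ccLp θ θ' g⟩

theorem norm_fourierInt_sub_le {f g : G → ℂ} (hf : Integrable f θ) (hg : Integrable g θ)
    (χ : PontryaginDual G) :
    ‖fourierInt θ f χ - fourierInt θ g χ‖ ≤ ∫ x, ‖f x - g x‖ ∂θ := by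
  have hint : ∀ {u : G → ℂ}, Integrable u θ →
      Integrable (fun x => u x * (starRingEnd ℂ) (χ x : ℂ)) θ := fun hu => by
    have hχ := map_continuous χ
    refine hu.mul_bdd (c := 1) (Continuous.aestronglyMeasurable (by fun_prop))
      (.of_forall fun x => ?_)
    simp [Circle.norm_coe]
  have : fourierInt θ f χ - fourierInt θ g χ = fourierInt θ (f - g) χ := by
    rw [fourierInt, fourierInt, fourierInt, ← integral_sub (hint hf) (hint hg)]
    refine integral_congr_ae (.of_forall fun x => ?_)
    simp [sub_mul]
  rw [this]
  exact norm_fourierInt_le θ _ χ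

/-- Approximate `f` in L¹ and L² by the same sequence in C_c. The transforms converge pointwise by
the L¹ bound, and along a subsequence a.e. to the Plancherel transform. -/
theorem fourierInt_ae_eq_plancherel {f : Lp ℂ 2 θ} (hf : Integrable f θ) :
    fourierInt θ f =ᵐ[θ'] plancherel θ θ' f := by
  have hex : ∀ n : ℕ, ∃ g : C_c(G, ℂ),
      eLpNorm (⇑f - ⇑g) 2 θ ≤ ENNReal.ofReal (1 / ((n : ℝ) + 1)) ∧
      eLpNorm (⇑f - ⇑g) 1 θ ≤ ENNReal.ofReal (1 / ((n : ℝ) + 1)) := fun n =>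
    exists_eLpNorm_sub_le le_rfl one_le_two (Lp.memLp f) (memLp_one_iff_integrable.2 hf)
      (by positivity)
  choose g hg2 hg1 using hex
  have hlim := tendsto_one_div_add_atTop_nhds_zero_nat (𝕜 := ℝ)
  have hL2 : Filter.Tendsto (fun n => ccLp θ (g n)) Filter.atTop (𝓝 f) := by
    refine tendsto_iff_norm_sub_tendsto_zero.2 (squeeze_zero (fun _ => norm_nonneg _)
      (fun n => ?_) hlim)
    rw [norm_sub_rev, Lp.norm_def]
    refine ENNReal.toReal_le_of_le_ofReal (by positivity) (le_trans (le_of_eq ?_) (hg2 n))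
    refine eLpNorm_congr_ae ?_
    filter_upwards [Lp.coeFn_sub f (ccLp θ (g n)), coeFn_ccLp (g n) (μ := θ)] with x h1 h2
    rw [h1, Pi.sub_apply, h2, Pi.sub_apply]
  have hpt : ∀ χ, Filter.Tendsto (fun n => fourierInt θ (g n) χ) Filter.atTop
      (𝓝 (fourierInt θ f χ)) := fun χ => by
    refine tendsto_iff_norm_sub_tendsto_zero.2 (squeeze_zero (fun _ => norm_nonneg _)
      (fun n => ?_) hlim)
    rw [norm_sub_rev]
    refine (norm_fourierInt_sub_le θ hf (g n).integrable χ).trans ?_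
    have h1 := integral_norm_eq_lintegral_enorm (hf.sub (g n).integrable).aestronglyMeasurable
    refine h1.trans_le (ENNReal.toReal_le_of_le_ofReal (by positivity) ?_)
    rw [← eLpNorm_one_eq_lintegral_enorm]
    exact hg1 n
  have hF := ((plancherel θ θ').continuous.tendsto f).comp hL2
  obtain ⟨ns, hns, hae⟩ := (tendstoInMeasure_of_tendsto_Lp hF).exists_seq_tendsto_ae
  have hall : ∀ᵐ χ ∂θ', ∀ n, plancherel θ θ' (ccLp θ (g n)) χ = fourierInt θ (g n) χ := by
    refine ae_all_iff.2 fun n => ?_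
    rw [plancherel_ccLp]
    exact coeFn_fourierCc θ θ' (g n)
  filter_upwards [hae, hall] with χ h1 h2
  refine tendsto_nhds_unique ((hpt χ).comp hns.tendsto_atTop) (h1.congr fun n => ?_)
  exact h2 (ns n)

theorem fourierL1L2_eq_plancherel {f : Lp ℂ 2 θ} (hf : Integrable f θ) :
    fourierL1L2 θ θ' f = plancherel θ θ' f := by
  have h := fourierInt_ae_eq_plancherel θ θ' hf
  have hm : MemLp (fourierInt θ f) 2 θ' := (memLp_congr_ae h).2 (Lp.memLp _)
  rw [fourierL1L2, dif_pos hm]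
  exact Lp.ext (hm.coeFn_toLp.trans h)

theorem fourierL2_eq_plancherel (f : Lp ℂ 2 θ) : fourierL2 θ θ' f = plancherel θ θ' f := by
  have hd : f ∈ closure {f : Lp ℂ 2 θ | Integrable f θ} := by
    refine closure_mono ?_ (denseRange_ccLp (μ := θ) f)
    rintro _ ⟨g, rfl⟩
    exact g.integrable.congr (coeFn_ccLp g).symm
  refine extendFrom_eq hd ((((plancherel θ θ').continuous.tendsto f).mono_left
    nhdsWithin_le_nhds).congr' ?_)
  filter_upwards [self_mem_nhdsWithin] with u hu using (fourierL1L2_eq_plancherel θ θ' hu).symm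

theorem PWSupp_eq_PW_iff [θ'.InnerRegularCompactLTTop] {K : Set (PontryaginDual G)}
    (hK : NullMeasurableSet K θ') : PWSupp θ θ' K = PW θ θ' K ↔ supp θ' (ind K) ⊆ K := by
  rw [← L2Supp_eq_L2On_iff hK]
  have h1 : PWSupp θ θ' K = plancherel θ θ' ⁻¹' (L2Supp θ' K : Set (Lp ℂ 2 θ')) := by
    ext f
    change supp θ' (fourierL2 θ θ' f) ⊆ K ↔ supp θ' (plancherel θ θ' f) ⊆ K
    rw [fourierL2_eq_plancherel]
  have h2 : PW θ θ' K = plancherel θ θ' ⁻¹' (L2On θ' K : Set (Lp ℂ 2 θ')) := by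
    ext f
    change (∀ᵐ χ ∂θ', χ ∉ K → fourierL2 θ θ' f χ = 0) ↔
      ∀ᵐ χ ∂θ', χ ∉ K → plancherel θ θ' f χ = 0
    rw [fourierL2_eq_plancherel]
  rw [h1, h2, (surjective_plancherel θ θ').preimage_injective.eq_iff, SetLike.coe_set_eq]

end Extension

end PaleyWiener

end

theorem mainTheorem9 {G : Type*} [CommGroup G] [TopologicalSpace G] [IsTopologicalGroup G]
    [LocallyCompactSpace G] [T2Space G] [MeasurableSpace G] [BorelSpace G]
    [MeasurableSpace (PontryaginDual G)] [BorelSpace (PontryaginDual G)]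
    (θ : Measure G) [θ.IsHaarMeasure] [θ.InnerRegularCompactLTTop]
    (θ' : Measure (PontryaginDual G)) [θ'.IsHaarMeasure] [θ'.InnerRegularCompactLTTop] :
    -- the two Paley-Wiener spaces
    (∀ K : Set (PontryaginDual G), NullMeasurableSet K θ' →
      (PaleyWiener.PWSupp θ θ' K = PaleyWiener.PW θ θ' K ↔
        PaleyWiener.supp θ' (PaleyWiener.ind K) ⊆ K)) ∧
    (∀ K : Set (PontryaginDual G), IsClosed K →
      PaleyWiener.PWSupp θ θ' K = PaleyWiener.PW θ θ' K) ∧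
    -- the spaces `L²(G : K)` and `L²(K)`
    (∀ K : Set G, NullMeasurableSet K θ →
      (PaleyWiener.L2Supp θ K).topologicalClosure = PaleyWiener.L2On θ K ∧
      PaleyWiener.L2On θ K ≤ PaleyWiener.L2Supp θ (PaleyWiener.supp θ (PaleyWiener.ind K)) ∧
      (PaleyWiener.L2On θ K = PaleyWiener.L2Supp θ (PaleyWiener.supp θ (PaleyWiener.ind K)) ↔
        ∀ C : Set G, IsCompact C → C ⊆ PaleyWiener.supp θ (PaleyWiener.ind K) \ K → θ C = 0) ∧
      (θ.InnerRegular →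
        (PaleyWiener.L2On θ K = PaleyWiener.L2Supp θ (PaleyWiener.supp θ (PaleyWiener.ind K)) ↔
          θ (PaleyWiener.supp θ (PaleyWiener.ind K) \ K) = 0)) ∧
      (PaleyWiener.supp θ (PaleyWiener.ind K) ⊆ K ↔
        IsClosed (PaleyWiener.L2Supp θ K : Set (Lp ℂ 2 θ)))) ∧
    (∀ K : Set G, IsClosed K →
      IsClosed (PaleyWiener.L2Supp θ K : Set (Lp ℂ 2 θ)) ∧
      (PaleyWiener.L2Supp θ K).topologicalClosure = PaleyWiener.L2On θ K ∧
      PaleyWiener.L2On θ K =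
        PaleyWiener.L2Supp θ (PaleyWiener.supp θ (PaleyWiener.ind K))) := by
  refine ⟨fun K hK => PaleyWiener.PWSupp_eq_PW_iff θ θ' hK, fun K hK => ?_, fun K hK =>
    ⟨PaleyWiener.topologicalClosure_L2Supp hK, PaleyWiener.L2On_le_L2Supp_supp_ind hK,
      PaleyWiener.L2On_eq_L2Supp_supp_ind_iff hK, fun hreg => ?_,
      PaleyWiener.supp_ind_subset_iff_isClosed_L2Supp hK⟩, fun K hK => ?_⟩
  · exact (PaleyWiener.PWSupp_eq_PW_iff θ θ' hK.measurableSet.nullMeasurableSet).2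
      (PaleyWiener.supp_ind_subset_of_isClosed hK)
  · rw [PaleyWiener.L2On_eq_L2Supp_supp_ind_iff hK, PaleyWiener.measure_eq_zero_iff_forall_isCompact
      ((PaleyWiener.isClosed_supp _).measurableSet.nullMeasurableSet.diff hK)]
  · have hm : NullMeasurableSet K θ := hK.measurableSet.nullMeasurableSet
    have hs : PaleyWiener.supp θ (PaleyWiener.ind K) ⊆ K :=
      PaleyWiener.supp_ind_subset_of_isClosed hK
    refine ⟨(PaleyWiener.supp_ind_subset_iff_isClosed_L2Supp hm).1 hs,
      PaleyWiener.topologicalClosure_L2Supp hm,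
      le_antisymm (PaleyWiener.L2On_le_L2Supp_supp_ind hm) ?_⟩
    exact (PaleyWiener.L2Supp_mono hs).trans (PaleyWiener.L2Supp_le_L2On K)
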